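/- Consider a finite Markov decision process with state space $S$, action space $A$, transition kernel $P_{\rm env}(s'\mid s,a)$ and reward $r(s,a)$, and a fixed policy $\pi$. Put $r_{\max}=\max_{s,a}|r(s,a)|$, $P(s'\mid s)=\sum_a P_{\rm env}(s'\mid s,a)\pi(a\mid s)$, $r_s=\sum_a\pi(a\mid s)r(s,a)$ and $R=(r_s)_{s\in S}$. Assume that the Markov chain with transition matrix $P$ is irreducible and aperiodic, let $\mu$ be its stationary distribution and $D=\mathrm{diag}(\mu)$. Let $\Phi\in\mathbb R^{S\times d}$ have linearly independent columns and rows $\phi(s)^\top$ with $\|\phi(s)\|\le 1$ (Euclidean norms throughout), and set \[ \eta=\min_{\|x\|=1}\ \|\Phi x\|_{\rm Dir}^2+(\mu^\top\Phi x)^2,\qquad \|f\|_{\rm Dir}^2=\tfrac12\sum_{s,s'}\mu(s)P(s'\mid s)(f(s)-f(s'))^2 . \] For $\varepsilon>0$ let $\tau_{\rm mix}(\varepsilon)$ be the least integer $\tau\ge0$ with $\max_s\sum_{s'}|P^{\tau}(s'\mid s)-\mu(s')|\le\varepsilon$. Let $(s_t)_{t\ge0}$ be a Markov chain with transition matrix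 $P$ (with any initial distribution). The projected single-chain algorithm with constant stepsizes $\alpha>0$, $\beta>0$ and projection radii $R_w$, $R_\theta$ is \[ w_{t+1}={\rm Proj}_{R_w}\{w_t+\beta(\phi(s_t)-w_t)\}, \] \[ \theta_{t+1}={\rm Proj}_{R_\theta}\big\{\theta_t+\alpha\big[(r_{s_t}+\phi(s_{t+1})^\top\theta_t-\phi(s_t)^\top\theta_t)\phi(s_t)-(r_{s_t}+\phi(s_t)^\top\theta_t)w_t\big]\big\}, \] where ${\rm Proj}_{\varrho}$ is the Euclidean projection onto the closed ball of radius $\varrho$ about $0$, and $w_0,\theta_0$ are deterministic with $\|w_0\|\le1$, $\|\theta_0\|\le R_\theta$. Let $w^*=\Phi^\top\mu$ and let $\theta^*$ be the solution of $\Phi^\top D(R+P\Phi\theta^*-\Phi\theta^*)-\mu^\top(R+\Phi\theta^*)\,w^*=0$. Assume $R_w\ge1$, $R_\theta>0$ and $\|\theta^*\|\le R_\theta$. Let $\rho_0=\beta/\alpha\le1$, $\tau_{\rm mix}=\tau_{\rm mix}(\min\{\alpha,\beta\})$, let $\lambda>0$ satisfy $\lambda^2<2\eta/(r_{\max}+2R_\theta)$,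 and put $\zeta=\eta-\lambda^2(r_{\max}+2R_\theta)/2$. Assume $\alpha<1/(2\zeta)$ and define \[ \kappa=1-2\alpha\zeta,\qquad G_1=e^{-2\rho_0\alpha},\qquad \rho=\max\{\kappa,G_1\}, \] \[ G_{\rm const}=\frac{(16\tau_{\rm mix}+6)(r_{\max}+2R_\theta)}{\lambda^2}+(88\tau_{\rm mix}+4)(r_{\max}+3R_\theta)^2 . \] Then $\zeta>0$, the numbers $\kappa,G_1,\rho$ lie in $(0,1)$, and for all $t\ge\tau_{\rm mix}$ \[ \mathbb E\|\theta_t-\theta^*\|^2\le\frac{4\alpha(r_{\max}+2R_\theta)(t-\tau_{\rm mix})\rho^{\,t-\tau_{\rm mix}}}{\lambda^2}+4R_\theta^2\kappa^{\,t-\tau_{\rm mix}}+\frac{\alpha\,G_{\rm const}}{2\zeta}. \] -/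

import Mathlib

open MeasureTheory Matrix

noncomputable section

namespace AvgRewardTD

/-- A finite Markov decision process with state space `S` and action space `A`:
`trans s a s'` is the probability of moving from `s` to `s'` under action `a`. -/
structure FiniteMDP (S A : Type*) [Fintype S] where
  trans : S → A → S → ℝ
  trans_nonneg : ∀ s a s', 0 ≤ trans s a s'
  trans_sum : ∀ s a, ∑ s', trans s a s' = 1
  reward : S → A → ℝ

/-- A stationary randomized policy: `prob s a` is the probability of action `a` in state `s`. -/
structure Policy (S A : Type*) [Fintype A] where
  prob : S → A → ℝ
  prob_nonneg : ∀ s a, 0 ≤ prob s a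
  prob_sum : ∀ s, ∑ a, prob s a = 1

/-- The largest absolute reward `max_{s,a} |r(s,a)|`. -/
def FiniteMDP.rMax {S A : Type*} [Fintype S] (M : FiniteMDP S A) : ℝ :=
  ⨆ p : S × A, |M.reward p.1 p.2|

/-- The transition matrix induced by the policy. -/
def FiniteMDP.transMatrix {S A : Type*} [Fintype S] [Fintype A]
    (M : FiniteMDP S A) (pol : Policy S A) : Matrix S S ℝ :=
  Matrix.of fun s s' => ∑ a, M.trans s a s' * pol.prob s a

/-- The expected one-step rewards under the policy. -/
def FiniteMDP.rewardVec {S A : Type*} [Fintype S] [Fintype A]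
    (M : FiniteMDP S A) (pol : Policy S A) : S → ℝ :=
  fun s => ∑ a, pol.prob s a * M.reward s a

section Chain

variable {S : Type*} [Fintype S] [DecidableEq S]

/-- Every state has period one: the only common divisor of its possible return times is `1`. -/
def IsAperiodic (P : Matrix S S ℝ) : Prop :=
  ∀ s, ∀ k : ℕ, (∀ n : ℕ, 0 < n → 0 < (P ^ n) s s → k ∣ n) → k = 1

/-- `μ` is a stationary probability distribution of `P`. -/
structure IsStationary (P : Matrix S S ℝ) (μ : S → ℝ) : Prop where
  nonneg : ∀ s, 0 ≤ μ s
  sum_one : ∑ s, μ s = 1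
  vecMul_eq : μ ᵥ* P = μ

/-- The mixing time at accuracy `ε`: the first `τ` at which the `τ`-step distributions from all
starting states are within `ε` of `μ` in `ℓ¹` norm. -/
def mixingTime (P : Matrix S S ℝ) (μ : S → ℝ) (ε : ℝ) : ℕ :=
  sInf {τ : ℕ | ∀ s, ∑ s', |(P ^ τ) s s' - μ s'| ≤ ε}

/-- The squared Dirichlet seminorm. -/
def dirichletSq (P : Matrix S S ℝ) (μ : S → ℝ) (f : S → ℝ) : ℝ :=
  (1 / 2) * ∑ s, ∑ s', μ s * P s s' * (f s - f s') ^ 2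

/-- The process `X` is a time-homogeneous Markov chain with transition matrix `P` (and an
arbitrary initial distribution). -/
structure IsMarkovChain {Ω : Type*} [MeasurableSpace Ω] (ℙ : Measure Ω)
    (P : Matrix S S ℝ) (X : ℕ → Ω → S) : Prop where
  measurableSet_eq : ∀ t x, MeasurableSet {ω | X t ω = x}
  prob_path : ∀ (n : ℕ) (x : ℕ → S),
    ℙ.real {ω | ∀ i ≤ n, X i ω = x i}
      = ℙ.real {ω | X 0 ω = x 0} * ∏ i ∈ Finset.range n, P (x i) (x (i + 1))

end Chain

section Algorithm

variable {S : Type*} {d : ℕ}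

/-- The feature vector of a state: the corresponding row of the feature matrix. -/
def feature (Φ : Matrix S (Fin d) ℝ) (s : S) : EuclideanSpace ℝ (Fin d) :=
  WithLp.toLp 2 (Φ s)

/-- Euclidean projection onto the closed ball of radius `R` about the origin. -/
def projBall (R : ℝ) (x : EuclideanSpace ℝ (Fin d)) : EuclideanSpace ℝ (Fin d) :=
  if ‖x‖ ≤ R then x else (R / ‖x‖) • x

/-- The update direction of the auxiliary iterate. -/
def fUpdate (Φ : Matrix S (Fin d) ℝ) (s : S) (w : EuclideanSpace ℝ (Fin d)) :
    EuclideanSpace ℝ (Fin d) :=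
  feature Φ s - w

/-- The update direction of the parameter iterate. -/
def gUpdate (Φ : Matrix S (Fin d) ℝ) (R : S → ℝ) (s s' : S)
    (w θ : EuclideanSpace ℝ (Fin d)) : EuclideanSpace ℝ (Fin d) :=
  (R s + inner ℝ (feature Φ s') θ - inner ℝ (feature Φ s) θ) • feature Φ s
    - (R s + inner ℝ (feature Φ s) θ) • w

/-- The iterates `(w_t, θ_t)` of the projected single-chain algorithm along a trajectory `x` of
states, the successor of `x t` being `x (t + 1)`. -/
def singleChain (Φ : Matrix S (Fin d) ℝ) (R : S → ℝ) (α β Rw Rθ : ℝ)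
    (w₀ θ₀ : EuclideanSpace ℝ (Fin d)) (x : ℕ → S) :
    ℕ → EuclideanSpace ℝ (Fin d) × EuclideanSpace ℝ (Fin d)
  | 0 => (w₀, θ₀)
  | t + 1 =>
    let p := singleChain Φ R α β Rw Rθ w₀ θ₀ x t
    (projBall Rw (p.1 + β • fUpdate Φ (x t) p.1),
      projBall Rθ (p.2 + α • gUpdate Φ R (x t) (x (t + 1)) p.1 p.2))

variable [Fintype S] [DecidableEq S]

/-- `w* = Φᵀ μ`. -/
def wStar (Φ : Matrix S (Fin d) ℝ) (μ : S → ℝ) : EuclideanSpace ℝ (Fin d) :=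
  WithLp.toLp 2 (Φᵀ *ᵥ μ)

/-- The stationary mean of `gUpdate`, where `D` is the diagonal matrix of `μ`:
`Φᵀ D (R + P Φ θ - Φ θ) - (μᵀ (R + Φ θ)) w`. -/
def gBar (P : Matrix S S ℝ) (μ : S → ℝ) (Φ : Matrix S (Fin d) ℝ) (R : S → ℝ)
    (w θ : EuclideanSpace ℝ (Fin d)) : EuclideanSpace ℝ (Fin d) :=
  WithLp.toLp 2 (Φᵀ *ᵥ (Matrix.diagonal μ *ᵥ (R + P *ᵥ (Φ *ᵥ θ.ofLp) - Φ *ᵥ θ.ofLp)))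
    - (μ ⬝ᵥ (R + Φ *ᵥ θ.ofLp)) • w

/-- The condition number `η = min_{‖x‖ = 1} ‖Φ x‖²_Dir + (μᵀ Φ x)²`. -/
def eta (P : Matrix S S ℝ) (μ : S → ℝ) (Φ : Matrix S (Fin d) ℝ) : ℝ :=
  sInf ((fun x : EuclideanSpace ℝ (Fin d) =>
    dirichletSq P μ (Φ *ᵥ x.ofLp) + (μ ⬝ᵥ (Φ *ᵥ x.ofLp)) ^ 2) '' Metric.sphere 0 1)

end Algorithm

end AvgRewardTD

end

/-! Write e = θ − θ*. The mean update `gBar` at w* is affine in θ, vanishes at θ*, and its linear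
part satisfies ⟨e, ·⟩ = −(‖Φe‖²_Dir + (μᵀΦe)²) ≤ −η‖e‖² (`inner_gBar_zero_wStar`,
`eta_mul_norm_sq_le`). Using w in place of w* costs at most (r + 2R_θ)‖e‖‖w − w*‖; Young's
inequality with weight λ² turns this into a loss of drift, from η to ζ, and a forcing term in ‖w −
w*‖²/λ² (`inner_gBar_le`). Projection does not increase the distance to θ*, so the mean-square error
contracts by κ per step, up to forcing, Markovian noise and O(α²).

For the noise, the successor state is integrated out exactly; what remains has μ-mean zero in the
current state when the iterates are held fixed. Freezing them τ steps back costs O(ατ), and given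
that past the current state is nearly stationary, so the noise is O(ατ) (`integral_tdNoise_le`). The
same device bounds E‖w − w*‖² by 4(1 − β)^(2k) + O(βτ) (`integral_norm_fst_sub_sq_le`). As (1 − β)²
≤ G₁ = exp(−2β), the recursion solves to the claimed form (`le_of_forced_recursion`).

The stated constants need three extra arguments. The forcing must carry G₁^(k+1) instead of G₁^k, a
change of at most 2β. If τ = 0 and α < 1, the chain has a single state and hence no noise. If α ≥
2/3, the last term of the bound already exceeds the trivial 4R_θ². -/

namespace AvgRewardTD

/-! ### Convergence of finite Markov chains to stationarity -/

section StochasticMatrix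

variable {S : Type*} [Fintype S] [DecidableEq S]

theorem pow_add_apply_pos {P : Matrix S S ℝ} (hP : ∀ i j, 0 ≤ P i j) {m n : ℕ} {i j k : S}
    (hm : 0 < (P ^ m) i j) (hn : 0 < (P ^ n) j k) : 0 < (P ^ (m + n)) i k := by
  rw [pow_add, Matrix.mul_apply]
  exact (mul_pos hm hn).trans_le (Finset.single_le_sum
    (f := fun l => (P ^ m) i l * (P ^ n) l k)
    (fun l _ => mul_nonneg (pow_apply_nonneg hP m i l) (pow_apply_nonneg hP n l k))
    (Finset.mem_univ j))

/-- Return times to `s` are closed under addition and have gcd 1, so they include all large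
integers. -/
theorem eventually_pow_apply_self_pos {P : Matrix S S ℝ} (hP : ∀ i j, 0 ≤ P i j)
    (haper : IsAperiodic P) (s : S) : ∀ᶠ m in Filter.atTop, 0 < (P ^ m) s s := by
  set T : Set ℕ := {n | 0 < n ∧ 0 < (P ^ n) s s} with hT
  have hgcd : Nat.setGcd T = 1 :=
    haper s _ fun n h0 hn => Nat.setGcd_dvd_of_mem (s := T) ⟨h0, hn⟩
  obtain ⟨N, hN⟩ := Nat.exists_mem_closure_of_ge T
  refine Filter.eventually_atTop.2 ⟨N, fun m hm => ?_⟩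
  have hmem := hN m hm (by rw [hgcd]; exact one_dvd m)
  clear hm
  induction hmem using AddSubmonoid.closure_induction with
  | mem x hx => exact hx.2
  | zero => simp
  | add x y _ _ hx hy => exact pow_add_apply_pos hP hx hy

theorem exists_pow_pos_of_isIrreducible {P : Matrix S S ℝ} (hirr : P.IsIrreducible)
    (haper : IsAperiodic P) : ∃ N, ∀ s s', 0 < (P ^ N) s s' := by
  have hP := hirr.nonneg
  have key : ∀ s s', ∀ᶠ m in Filter.atTop, 0 < (P ^ m) s s' := by
    intro s s'
    obtain ⟨k, -, hk⟩ := (isIrreducible_iff_exists_pow_pos hP).1 hirr s s'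
    obtain ⟨N, hN⟩ := Filter.eventually_atTop.1 (eventually_pow_apply_self_pos hP haper s)
    refine Filter.eventually_atTop.2 ⟨N + k, fun m hm => ?_⟩
    obtain ⟨l, rfl⟩ := Nat.exists_eq_add_of_le hm
    have := pow_add_apply_pos hP (hN (N + l) (by omega)) hk
    rwa [show N + l + k = N + k + l by ring] at this
  exact (Filter.eventually_all.2 fun s => Filter.eventually_all.2 fun s' => key s s').exists

omit [DecidableEq S] in
-- Doeblin contraction: as `v` has total mass zero, the part δμ common to all rows of `Q` can be
-- removed without changing `v ᵥ* Q`, and the nonnegative remainders have mass 1 − δ.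
theorem sum_abs_vecMul_le {Q : Matrix S S ℝ} {μ : S → ℝ} {δ : ℝ}
    (hQ : ∀ i j, δ * μ j ≤ Q i j) (hrow : ∀ i, ∑ j, Q i j = 1) (hμ : ∑ j, μ j = 1)
    {v : S → ℝ} (hv : ∑ i, v i = 0) :
    ∑ j, |(v ᵥ* Q) j| ≤ (1 - δ) * ∑ i, |v i| := by
  have h1 : ∀ j, (v ᵥ* Q) j = ∑ i, v i * (Q i j - δ * μ j) := by
    intro j
    simp only [mul_sub, Finset.sum_sub_distrib, ← Finset.sum_mul, hv, vecMul, dotProduct]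
    ring
  calc ∑ j, |(v ᵥ* Q) j| ≤ ∑ j, ∑ i, |v i| * (Q i j - δ * μ j) := by
        refine Finset.sum_le_sum fun j _ => ?_
        rw [h1]
        refine (Finset.abs_sum_le_sum_abs _ _).trans_eq (Finset.sum_congr rfl fun i _ => ?_)
        rw [abs_mul, abs_of_nonneg (sub_nonneg.2 (hQ i j))]
    _ = (1 - δ) * ∑ i, |v i| := by
        rw [Finset.sum_comm, Finset.mul_sum]
        refine Finset.sum_congr rfl fun i _ => ?_
        rw [← Finset.mul_sum, Finset.sum_sub_distrib, hrow, ← Finset.mul_sum, hμ]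
        ring

theorem IsStationary.vecMul_pow {P : Matrix S S ℝ} {μ : S → ℝ} (hμ : IsStationary P μ) (n : ℕ) :
    μ ᵥ* P ^ n = μ := by
  induction n with
  | zero => simp
  | succ n ih => rw [pow_succ, ← vecMul_vecMul, ih, hμ.vecMul_eq]

omit [DecidableEq S] in
theorem IsStationary.le_one {P : Matrix S S ℝ} {μ : S → ℝ} (hμ : IsStationary P μ) (s : S) :
    μ s ≤ 1 := by
  rw [← hμ.sum_one]
  exact Finset.single_le_sum (fun i _ => hμ.nonneg i) (Finset.mem_univ s)

/-- A positive power with smallest entry δ dominates δμ because μ ≤ 1, so the distance to μ shrinks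
by 1 − δ every `N` steps. This makes the set in `mixingTime` nonempty, so that its `sInf` is
attained and is not a default value. -/
theorem exists_sum_abs_pow_sub_le {P : Matrix S S ℝ} (hirr : P.IsIrreducible)
    (haper : IsAperiodic P) (hPs : P ∈ rowStochastic ℝ S) {μ : S → ℝ} (hμ : IsStationary P μ)
    {ε : ℝ} (hε : 0 < ε) : ∃ τ : ℕ, ∀ s, ∑ s', |(P ^ τ) s s' - μ s'| ≤ ε := by
  obtain ⟨N, hN⟩ := exists_pow_pos_of_isIrreducible hirr haper
  rcases isEmpty_or_nonempty S with hS | hS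
  · exact ⟨0, fun s => hS.elim s⟩
  obtain ⟨p, hp⟩ := Finite.exists_min (fun p : S × S => (P ^ N) p.1 p.2)
  set δ := (P ^ N) p.1 p.2
  have hδ : 0 < δ := hN _ _
  have hQ := Submonoid.pow_mem _ hPs N
  have hδ1 : δ ≤ 1 := le_one_of_mem_rowStochastic hQ
  have hmin : ∀ i j, δ * μ j ≤ (P ^ N) i j := fun i j =>
    (mul_le_of_le_one_right hδ.le (hμ.le_one j)).trans (hp (i, j))
  have hrow := fun i => sum_row_of_mem_rowStochastic hQ i
  have hbound : ∀ (k : ℕ) (s : S),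
      ∑ s', |(P ^ (N * k)) s s' - μ s'| ≤ (1 - δ) ^ k * 2 := by
    intro k
    induction k with
    | zero =>
      intro s
      calc ∑ s', |(P ^ (N * 0)) s s' - μ s'| ≤ ∑ s', ((1 : Matrix S S ℝ) s s' + μ s') := by
            refine Finset.sum_le_sum fun s' _ => ?_
            rw [mul_zero, pow_zero]
            refine (abs_sub _ _).trans_eq ?_
            rw [abs_of_nonneg (hμ.nonneg s'), abs_of_nonneg]
            rw [one_apply]; split_ifs <;> norm_num
        _ ≤ (1 - δ) ^ 0 * 2 := by
            rw [Finset.sum_add_distrib, hμ.sum_one]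
            simp [one_apply]
            norm_num
    | succ k ih =>
      intro s
      have hv : ∑ i, ((P ^ (N * k)) s i - μ i) = 0 := by
        rw [Finset.sum_sub_distrib, hμ.sum_one,
          sum_row_of_mem_rowStochastic (Submonoid.pow_mem _ hPs _), sub_self]
      have h1 : ∀ s', (P ^ (N * (k + 1))) s s' - μ s'
          = ((fun i => (P ^ (N * k)) s i - μ i) ᵥ* (P ^ N)) s' := by
        intro s'
        have h2 := congrFun (hμ.vecMul_pow N) s'
        rw [mul_add, mul_one, pow_add, mul_apply]
        simp only [vecMul, dotProduct, sub_mul, Finset.sum_sub_distrib] at h2 ⊢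
        rw [h2]
      simp_rw [h1]
      calc _ ≤ (1 - δ) * ∑ i, |(P ^ (N * k)) s i - μ i| :=
            sum_abs_vecMul_le hmin hrow hμ.sum_one hv
        _ ≤ (1 - δ) * ((1 - δ) ^ k * 2) :=
            mul_le_mul_of_nonneg_left (ih s) (by linarith)
        _ = _ := by ring
  obtain ⟨k, hk⟩ := exists_pow_lt_of_lt_one (half_pos hε) (show 1 - δ < 1 by linarith)
  exact ⟨N * k, fun s => (hbound k s).trans (by linarith)⟩

theorem sum_abs_pow_mixingTime_sub_le {P : Matrix S S ℝ} (hirr : P.IsIrreducible)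
    (haper : IsAperiodic P) (hPs : P ∈ rowStochastic ℝ S) {μ : S → ℝ} (hμ : IsStationary P μ)
    {ε : ℝ} (hε : 0 < ε) (s : S) :
    ∑ s', |(P ^ mixingTime P μ ε) s s' - μ s'| ≤ ε :=
  Nat.sInf_mem (s := {τ : ℕ | ∀ s, ∑ s', |(P ^ τ) s s' - μ s'| ≤ ε})
    (exists_sum_abs_pow_sub_le hirr haper hPs hμ hε) s

/-- Distinct states cannot all carry more than half of the stationary mass. -/
theorem subsingleton_of_sum_abs_one_sub_lt {P : Matrix S S ℝ} {μ : S → ℝ}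
    (hμ : IsStationary P μ) (h : ∀ s, ∑ s', |(1 : Matrix S S ℝ) s s' - μ s'| < 1) :
    Subsingleton S := by
  -- Both distributions sum to one, so the off-diagonal entries contribute at least 1 − μ s, as much
  -- as the diagonal one.
  have half : ∀ s, 1 / 2 < μ s := by
    intro s
    have h1 : ∑ s', ((1 : Matrix S S ℝ) s s' - μ s') = 0 := by
      rw [Finset.sum_sub_distrib, hμ.sum_one]; simp [one_apply]
    rw [← Finset.add_sum_erase _ _ (Finset.mem_univ s)] at h1
    have h2 := h s
    rw [← Finset.add_sum_erase _ _ (Finset.mem_univ s)] at h2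
    have h3 := Finset.abs_sum_le_sum_abs (fun s' => (1 : Matrix S S ℝ) s s' - μ s')
      (Finset.univ.erase s)
    have h4 := neg_le_abs (∑ s' ∈ Finset.univ.erase s, ((1 : Matrix S S ℝ) s s' - μ s'))
    have h5 := le_abs_self ((1 : Matrix S S ℝ) s s - μ s)
    simp only [one_apply_eq] at h1 h2 h5
    linarith
  refine ⟨fun a b => by_contra fun hab => ?_⟩
  have := Finset.sum_le_sum_of_subset_of_nonneg (Finset.subset_univ {a, b})
    (fun i _ _ => hμ.nonneg i)
  rw [Finset.sum_pair hab, hμ.sum_one] at this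
  linarith [half a, half b]

theorem FiniteMDP.transMatrix_mem_rowStochastic {A : Type*} [Fintype A]
    (M : FiniteMDP S A) (pol : Policy S A) : M.transMatrix pol ∈ rowStochastic ℝ S := by
  refine mem_rowStochastic_iff_sum.2 ⟨fun i j => Finset.sum_nonneg fun a _ =>
    mul_nonneg (M.trans_nonneg i a j) (pol.prob_nonneg i a), fun i => ?_⟩
  simp only [FiniteMDP.transMatrix, of_apply]
  rw [Finset.sum_comm]
  simp_rw [← Finset.sum_mul, M.trans_sum, one_mul, pol.prob_sum]

omit [DecidableEq S] in
theorem FiniteMDP.rMax_nonneg {A : Type*} (M : FiniteMDP S A) : 0 ≤ M.rMax :=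
  Real.iSup_nonneg fun _ => abs_nonneg _

omit [DecidableEq S] in
theorem FiniteMDP.abs_rewardVec_le {A : Type*} [Fintype A] (M : FiniteMDP S A)
    (pol : Policy S A) (s : S) : |M.rewardVec pol s| ≤ M.rMax := by
  have h : ∀ a, |M.reward s a| ≤ M.rMax := fun a =>
    le_ciSup (f := fun p : S × A => |M.reward p.1 p.2|) (Set.finite_range _).bddAbove (s, a)
  calc |M.rewardVec pol s| ≤ ∑ a, pol.prob s a * M.rMax := by
        refine (Finset.abs_sum_le_sum_abs _ _).trans (Finset.sum_le_sum fun a _ => ?_)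
        rw [abs_mul, abs_of_nonneg (pol.prob_nonneg s a)]
        exact mul_le_mul_of_nonneg_left (h a) (pol.prob_nonneg s a)
    _ = M.rMax := by rw [← Finset.sum_mul, pol.prob_sum, one_mul]

end StochasticMatrix

/-! ### Functionals of the past and the Markov property -/

section PathFunctional

variable {S : Type*}

/-- A path functional that only looks at the first `n + 1` states. -/
def DependsUpTo {E : Type*} (n : ℕ) (F : (ℕ → S) → E) : Prop :=
  ∀ x y : ℕ → S, (∀ i ≤ n, x i = y i) → F x = F y

theorem DependsUpTo.mono {E : Type*} {m n : ℕ} {F : (ℕ → S) → E} (hF : DependsUpTo m F)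
    (h : m ≤ n) : DependsUpTo n F :=
  fun x y hxy => hF x y fun i hi => hxy i (hi.trans h)

/-- The path through the states of `y`, constant after time `n`. -/
def extendPath {n : ℕ} (y : Fin (n + 1) → S) (i : ℕ) : S :=
  y ⟨min i n, by omega⟩

theorem extendPath_restrict (n : ℕ) (x : ℕ → S) (i : ℕ) (hi : i ≤ n) :
    extendPath (fun j : Fin (n + 1) => x j) i = x i := by
  simp [extendPath, hi]

theorem eq_restrict_of_extendPath {n : ℕ} {x : ℕ → S} {y : Fin (n + 1) → S}
    (h : ∀ i ≤ n, x i = extendPath y i) : y = fun j : Fin (n + 1) => x j := by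
  funext j
  rw [h j (by omega)]
  simp [extendPath, show (j : ℕ) ≤ n by omega]

variable [Fintype S] [DecidableEq S] {Ω : Type*} [MeasurableSpace Ω] {ℙ : Measure Ω}
  {P : Matrix S S ℝ} {X : ℕ → Ω → S}

omit [Fintype S] [DecidableEq S] in
theorem IsMarkovChain.measurableSet_path (hX : IsMarkovChain ℙ P X) (n : ℕ) (x : ℕ → S) :
    MeasurableSet {ω | ∀ i ≤ n, X i ω = x i} := by
  simp only [Set.ofPred_forall]
  exact MeasurableSet.iInter fun i => MeasurableSet.iInter fun _ => hX.measurableSet_eq i (x i)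

omit [DecidableEq S] [MeasurableSpace Ω] in
-- There are finitely many cylinders of a given length, so a functional of the past is a simple
-- function. Integrability then needs no measurability argument about the algorithm.
theorem DependsUpTo.eq_sum_indicator {n : ℕ} {F : (ℕ → S) → ℝ} (hF : DependsUpTo n F) (ω : Ω) :
    F (fun i => X i ω) = ∑ y : Fin (n + 1) → S,
      {ω | ∀ i ≤ n, X i ω = extendPath y i}.indicator (fun _ => F (extendPath y)) ω := by
  classical
  rw [Finset.sum_eq_single (fun j : Fin (n + 1) => X j ω)]
  · rw [Set.indicator_of_mem]
    · exact hF _ _ fun i hi => (extendPath_restrict n (fun i => X i ω) i hi).symm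
    · exact fun i hi => (extendPath_restrict n (fun i => X i ω) i hi).symm
  · intro y _ hy
    refine Set.indicator_of_notMem (fun h => hy ?_) _
    have h' : ∀ i ≤ n, X i ω = extendPath y i := h
    exact eq_restrict_of_extendPath (x := fun i => X i ω) h'
  · simp

variable [IsProbabilityMeasure ℙ]

omit [DecidableEq S] in
theorem DependsUpTo.integrable {n : ℕ} {F : (ℕ → S) → ℝ} (hF : DependsUpTo n F)
    (hX : IsMarkovChain ℙ P X) : Integrable (fun ω => F (fun i => X i ω)) ℙ := by
  rw [show (fun ω => F (fun i => X i ω)) = fun ω => ∑ y : Fin (n + 1) → S,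
      {ω | ∀ i ≤ n, X i ω = extendPath y i}.indicator (fun _ => F (extendPath y)) ω from
    funext fun ω => hF.eq_sum_indicator ω]
  exact integrable_finsetSum _ fun y _ =>
    (integrable_const _).indicator (hX.measurableSet_path n _)

omit [DecidableEq S] in
theorem DependsUpTo.integral_eq {n : ℕ} {F : (ℕ → S) → ℝ} (hF : DependsUpTo n F)
    (hX : IsMarkovChain ℙ P X) :
    ∫ ω, F (fun i => X i ω) ∂ℙ = ∑ y : Fin (n + 1) → S,
      ℙ.real {ω | ∀ i ≤ n, X i ω = extendPath y i} * F (extendPath y) := by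
  simp_rw [hF.eq_sum_indicator]
  rw [integral_finsetSum _ fun y _ =>
    (integrable_const _).indicator (hX.measurableSet_path n _)]
  refine Finset.sum_congr rfl fun y _ => ?_
  rw [integral_indicator (hX.measurableSet_path n _), setIntegral_const, smul_eq_mul]

omit [Fintype S] [DecidableEq S] [IsProbabilityMeasure ℙ] in
-- The Markov property as a product formula, with no conditioning and so no exception for null
-- paths: compare `prob_path` at `n` and `n + 1`.
theorem IsMarkovChain.prob_path_succ (hX : IsMarkovChain ℙ P X) (n : ℕ) (x : ℕ → S) (s : S) :
    ℙ.real {ω | (∀ i ≤ n, X i ω = x i) ∧ X (n + 1) ω = s}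
      = ℙ.real {ω | ∀ i ≤ n, X i ω = x i} * P (x n) s := by
  have h := hX.prob_path (n + 1) (Function.update x (n + 1) s)
  have hup : ∀ i ≤ n, Function.update x (n + 1) s i = x i := fun i hi =>
    Function.update_of_ne (by omega) _ _
  have hset : {ω | ∀ i ≤ n + 1, X i ω = Function.update x (n + 1) s i}
      = {ω | (∀ i ≤ n, X i ω = x i) ∧ X (n + 1) ω = s} := by
    ext ω
    constructor
    · intro hω
      refine ⟨fun i hi => (hω i (by omega)).trans (hup i hi), ?_⟩
      simpa using hω (n + 1) le_rfl
    · rintro ⟨h1, h2⟩ i hi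
      rcases Nat.lt_or_ge n i with h3 | h3
      · obtain rfl : i = n + 1 := by omega
        simpa using h2
      · rw [hup i h3, h1 i h3]
  rw [hset, Finset.prod_range_succ, hup 0 (by omega), hup n le_rfl, Function.update_self,
    ← mul_assoc] at h
  rw [h, hX.prob_path n x]
  congr 2
  refine Finset.prod_congr rfl fun i hi => ?_
  have := Finset.mem_range.1 hi
  rw [hup i (by omega), hup (i + 1) (by omega)]

theorem IsMarkovChain.integral_succ (hX : IsMarkovChain ℙ P X) {n : ℕ}
    {H : S → (ℕ → S) → ℝ} (hH : ∀ s, DependsUpTo n (H s)) :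
    ∫ ω, H (X (n + 1) ω) (fun i => X i ω) ∂ℙ
      = ∫ ω, ∑ s, P (X n ω) s * H s (fun i => X i ω) ∂ℙ := by
  have hR : DependsUpTo n fun x : ℕ → S => ∑ s, P (x n) s * H s x := fun x y hxy => by
    simp only [hxy n le_rfl]
    exact Finset.sum_congr rfl fun s _ => by rw [hH s x y hxy]
  rw [hR.integral_eq hX]
  have hpt : ∀ ω, H (X (n + 1) ω) (fun i => X i ω) = ∑ y : Fin (n + 1) → S, ∑ s,
      {ω | (∀ i ≤ n, X i ω = extendPath y i) ∧ X (n + 1) ω = s}.indicator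
        (fun _ => H s (extendPath y)) ω := by
    intro ω
    rw [(hH (X (n + 1) ω)).eq_sum_indicator]
    refine Finset.sum_congr rfl fun y _ => ?_
    rw [Finset.sum_eq_single (X (n + 1) ω)]
    · simp [Set.indicator]
    · intro s _ hs
      exact Set.indicator_of_notMem (fun h => hs h.2.symm) _
    · simp
  have hmeas : ∀ (y : Fin (n + 1) → S) (s : S),
      MeasurableSet {ω | (∀ i ≤ n, X i ω = extendPath y i) ∧ X (n + 1) ω = s} := fun y s =>
    (hX.measurableSet_path n _).inter (hX.measurableSet_eq (n + 1) s)
  have hint : ∀ (y : Fin (n + 1) → S) (s : S), Integrable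
      ({ω | (∀ i ≤ n, X i ω = extendPath y i) ∧ X (n + 1) ω = s}.indicator
        (fun _ => H s (extendPath y))) ℙ := fun y s =>
    (integrable_const _).indicator (hmeas y s)
  simp_rw [hpt]
  rw [integral_finsetSum _ fun y _ => integrable_finsetSum _ fun s _ => hint y s]
  refine Finset.sum_congr rfl fun y _ => ?_
  rw [integral_finsetSum _ fun s _ => hint y s, Finset.mul_sum]
  refine Finset.sum_congr rfl fun s _ => ?_
  rw [integral_indicator (hmeas y s), setIntegral_const, smul_eq_mul, hX.prob_path_succ,
    mul_assoc]

theorem IsMarkovChain.integral_add (hX : IsMarkovChain ℙ P X) {m : ℕ} (k : ℕ)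
    {H : S → (ℕ → S) → ℝ} (hH : ∀ s, DependsUpTo m (H s)) :
    ∫ ω, H (X (m + k) ω) (fun i => X i ω) ∂ℙ
      = ∫ ω, ∑ s, (P ^ k) (X m ω) s * H s (fun i => X i ω) ∂ℙ := by
  induction k generalizing H with
  | zero => simp [one_apply]
  | succ k ih =>
    rw [← add_assoc, hX.integral_succ fun s => (hH s).mono (Nat.le_add_right m k)]
    rw [ih (H := fun s x => ∑ s', P s s' * H s' x)
      fun s x y hxy => Finset.sum_congr rfl fun s' _ => by rw [hH s' x y hxy]]
    congr 1
    funext ω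
    simp_rw [pow_succ, mul_apply, Finset.sum_mul, Finset.mul_sum]
    rw [Finset.sum_comm]
    simp_rw [mul_assoc]

/-- After `k` steps of near-mixing, the state decouples from a bounded functional of the past. -/
theorem IsMarkovChain.integral_add_le (hX : IsMarkovChain ℙ P X) {m k : ℕ}
    {H : S → (ℕ → S) → ℝ} (hH : ∀ s, DependsUpTo m (H s)) {μ : S → ℝ} {ε C : ℝ}
    (hmix : ∀ s, ∑ s', |(P ^ k) s s' - μ s'| ≤ ε) (hC : ∀ s x, |H s x| ≤ C)
    (hμ : ∀ x, ∑ s, μ s * H s x = 0) :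
    ∫ ω, H (X (m + k) ω) (fun i => X i ω) ∂ℙ ≤ ε * C := by
  rw [hX.integral_add k hH]
  have hdep : DependsUpTo m fun x : ℕ → S => ∑ s, (P ^ k) (x m) s * H s x := fun x y hxy => by
    simp only [hxy m le_rfl]
    exact Finset.sum_congr rfl fun s _ => by rw [hH s x y hxy]
  refine (integral_mono (hdep.integrable hX) (integrable_const (ε * C)) fun ω => ?_).trans_eq
    (by simp)
  set x : ℕ → S := fun i => X i ω
  have hC0 : 0 ≤ C := (abs_nonneg _).trans (hC (X m ω) x)
  -- Since `H` has μ-mean zero, μ may be subtracted from the `k`-step law at no cost.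
  calc ∑ s, (P ^ k) (X m ω) s * H s x
      = ∑ s, ((P ^ k) (X m ω) s - μ s) * H s x := by
        simp_rw [sub_mul, Finset.sum_sub_distrib, hμ, sub_zero]
    _ ≤ ∑ s, |(P ^ k) (X m ω) s - μ s| * C := by
        refine Finset.sum_le_sum fun s _ => (le_abs_self _).trans ?_
        rw [abs_mul]
        exact mul_le_mul_of_nonneg_left (hC s x) (abs_nonneg _)
    _ ≤ ε * C := by
        rw [← Finset.sum_mul]
        exact mul_le_mul_of_nonneg_right (hmix _) hC0

end PathFunctional

/-! ### Euclidean projection onto a ball -/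

section Projection

variable {d : ℕ} {ϱ : ℝ} {x y : EuclideanSpace ℝ (Fin d)}

theorem projBall_of_norm_le (hx : ‖x‖ ≤ ϱ) : projBall ϱ x = x := if_pos hx

theorem norm_projBall_le (hϱ : 0 ≤ ϱ) : ‖projBall ϱ x‖ ≤ ϱ := by
  unfold projBall
  split_ifs with h
  · exact h
  · have hx : 0 < ‖x‖ := hϱ.trans_lt (not_le.1 h)
    rw [norm_smul, Real.norm_of_nonneg (by positivity), div_mul_cancel₀ _ hx.ne']

/-- Only `y` has to lie in the ball. With c = ϱ/‖x‖, Cauchy–Schwarz gives ⟨x, y⟩ ≤ c‖x‖², and the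
squared distance drops by at least (1 − c)²‖x‖². -/
theorem norm_projBall_sub_le (hϱ : 0 ≤ ϱ) (hy : ‖y‖ ≤ ϱ) : ‖projBall ϱ x - y‖ ≤ ‖x - y‖ := by
  unfold projBall
  split_ifs with h
  · exact le_rfl
  · have hx : 0 < ‖x‖ := hϱ.trans_lt (not_le.1 h)
    set c := ϱ / ‖x‖ with hc
    have hc0 : 0 ≤ c := by positivity
    have hc1 : c ≤ 1 := (div_le_one hx).2 (not_le.1 h).le
    have hcx : ϱ = c * ‖x‖ := (div_mul_cancel₀ _ hx.ne').symm
    have hxy : inner ℝ x y ≤ c * ‖x‖ ^ 2 := by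
      refine (real_inner_le_norm x y).trans ?_
      rw [show c * ‖x‖ ^ 2 = ‖x‖ * (c * ‖x‖) by ring, ← hcx]
      exact mul_le_mul_of_nonneg_left hy hx.le
    refine le_of_sq_le_sq ?_ (norm_nonneg _)
    rw [norm_sub_sq_real, norm_sub_sq_real, norm_smul, Real.norm_of_nonneg hc0, inner_smul_left]
    simp only [conj_trivial]
    nlinarith [mul_nonneg (sub_nonneg.2 hc1) (sub_nonneg.2 hxy),
      mul_nonneg (mul_nonneg (sub_nonneg.2 hc1) (sub_nonneg.2 hc1)) (sq_nonneg ‖x‖)]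

end Projection

theorem norm_sum_smul_le_of_forall_le {ι E : Type*} [Fintype ι] [NormedAddCommGroup E]
    [NormedSpace ℝ E] {p : ι → ℝ} {v : ι → E} {C : ℝ} (hp : ∀ i, 0 ≤ p i) (hp1 : ∑ i, p i = 1)
    (hv : ∀ i, ‖v i‖ ≤ C) : ‖∑ i, p i • v i‖ ≤ C := by
  calc ‖∑ i, p i • v i‖ ≤ ∑ i, p i * C := by
        refine (norm_sum_le _ _).trans (Finset.sum_le_sum fun i _ => ?_)
        rw [norm_smul, Real.norm_of_nonneg (hp i)]
        exact mul_le_mul_of_nonneg_left (hv i) (hp i)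
    _ = C := by rw [← Finset.sum_mul, hp1, one_mul]

/-! ### Size and Lipschitz bounds for the updates and their means -/

section Update

variable {S : Type*} {d : ℕ} {Φ : Matrix S (Fin d) ℝ} {R : S → ℝ} {r ϱ : ℝ}

theorem inner_feature (Φ : Matrix S (Fin d) ℝ) (s : S) (θ : EuclideanSpace ℝ (Fin d)) :
    inner ℝ (feature Φ s) θ = (Φ *ᵥ θ.ofLp) s := by
  simp [feature, PiLp.inner_apply, mulVec, dotProduct, mul_comm]

theorem abs_inner_feature_le (hΦ : ∀ s, ‖feature Φ s‖ ≤ 1) (s : S)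
    (θ : EuclideanSpace ℝ (Fin d)) : |inner ℝ (feature Φ s) θ| ≤ ‖θ‖ :=
  (abs_real_inner_le_norm _ _).trans (mul_le_of_le_one_left (norm_nonneg _) (hΦ s))

theorem norm_gUpdate_le (hΦ : ∀ s, ‖feature Φ s‖ ≤ 1) (hR : ∀ s, |R s| ≤ r)
    {w θ : EuclideanSpace ℝ (Fin d)} (hw : ‖w‖ ≤ 1) (hθ : ‖θ‖ ≤ ϱ) (s s' : S) :
    ‖gUpdate Φ R s s' w θ‖ ≤ 2 * r + 3 * ϱ := by
  have h1 := abs_le.1 ((abs_inner_feature_le hΦ s θ).trans hθ)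
  have h2 := abs_le.1 ((abs_inner_feature_le hΦ s' θ).trans hθ)
  have h3 := abs_le.1 (hR s)
  have h4 : |R s + inner ℝ (feature Φ s') θ - inner ℝ (feature Φ s) θ| ≤ r + 2 * ϱ :=
    abs_le.2 ⟨by linarith, by linarith⟩
  have h5 : |R s + inner ℝ (feature Φ s) θ| ≤ r + ϱ := abs_le.2 ⟨by linarith, by linarith⟩
  refine (norm_sub_le _ _).trans ?_
  rw [norm_smul, norm_smul, Real.norm_eq_abs, Real.norm_eq_abs]
  nlinarith [mul_le_of_le_one_right (abs_nonneg
    (R s + inner ℝ (feature Φ s') θ - inner ℝ (feature Φ s) θ)) (hΦ s),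
    mul_le_of_le_one_right (abs_nonneg (R s + inner ℝ (feature Φ s) θ)) hw]

theorem norm_gUpdate_sub_le (hΦ : ∀ s, ‖feature Φ s‖ ≤ 1) (hR : ∀ s, |R s| ≤ r)
    {w w' θ θ' : EuclideanSpace ℝ (Fin d)} (hw : ‖w‖ ≤ 1) (hθ' : ‖θ'‖ ≤ ϱ) (s s' : S) :
    ‖gUpdate Φ R s s' w θ - gUpdate Φ R s s' w' θ'‖
      ≤ 3 * ‖θ - θ'‖ + (r + ϱ) * ‖w - w'‖ := by
  -- θ is changed with `w` fixed, then `w` with θ' fixed, so only `w` and θ' need bounds. The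
  -- constant 3 is 2 from the temporal difference plus 1 from the average-reward term.
  have h0 : gUpdate Φ R s s' w θ - gUpdate Φ R s s' w' θ'
      = (inner ℝ (feature Φ s') (θ - θ') - inner ℝ (feature Φ s) (θ - θ')) • feature Φ s
        - inner ℝ (feature Φ s) (θ - θ') • w
        - (R s + inner ℝ (feature Φ s) θ') • (w - w') := by
    simp only [gUpdate, inner_sub_right]
    module
  have h1 := abs_le.1 (abs_inner_feature_le hΦ s (θ - θ'))
  have h2 := abs_le.1 (abs_inner_feature_le hΦ s' (θ - θ'))
  have h3 := abs_le.1 ((abs_inner_feature_le hΦ s θ').trans hθ')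
  have h4 := abs_le.1 (hR s)
  have h5 : |inner ℝ (feature Φ s') (θ - θ') - inner ℝ (feature Φ s) (θ - θ')|
      ≤ 2 * ‖θ - θ'‖ := abs_le.2 ⟨by linarith, by linarith⟩
  have h6 : |R s + inner ℝ (feature Φ s) θ'| ≤ r + ϱ := abs_le.2 ⟨by linarith, by linarith⟩
  rw [h0]
  refine (norm_sub_le _ _).trans ?_
  have h7 := norm_sub_le
    ((inner ℝ (feature Φ s') (θ - θ') - inner ℝ (feature Φ s) (θ - θ')) • feature Φ s)
    (inner ℝ (feature Φ s) (θ - θ') • w)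
  rw [norm_smul, norm_smul, Real.norm_eq_abs, Real.norm_eq_abs] at h7
  rw [norm_smul, Real.norm_eq_abs]
  have h8 := mul_le_of_le_one_right (abs_nonneg
    (inner ℝ (feature Φ s') (θ - θ') - inner ℝ (feature Φ s) (θ - θ'))) (hΦ s)
  have h9 := mul_le_of_le_one_right (abs_nonneg (inner ℝ (feature Φ s) (θ - θ'))) hw
  have h10 := mul_le_mul_of_nonneg_right h6 (norm_nonneg (w - w'))
  have h11 := abs_inner_feature_le hΦ s (θ - θ')
  linarith

variable [Fintype S]

/-- The conditional mean of `gUpdate` given the current state. -/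
noncomputable def gMean (P : Matrix S S ℝ) (Φ : Matrix S (Fin d) ℝ) (R : S → ℝ) (s : S)
    (w θ : EuclideanSpace ℝ (Fin d)) : EuclideanSpace ℝ (Fin d) :=
  ∑ s', P s s' • gUpdate Φ R s s' w θ

variable [DecidableEq S] {P : Matrix S S ℝ} {μ : S → ℝ}

theorem norm_gMean_le (hP : P ∈ rowStochastic ℝ S) (hΦ : ∀ s, ‖feature Φ s‖ ≤ 1)
    (hR : ∀ s, |R s| ≤ r) {w θ : EuclideanSpace ℝ (Fin d)} (hw : ‖w‖ ≤ 1) (hθ : ‖θ‖ ≤ ϱ)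
    (s : S) : ‖gMean P Φ R s w θ‖ ≤ 2 * r + 3 * ϱ :=
  norm_sum_smul_le_of_forall_le (fun s' => hP.1 s s') (sum_row_of_mem_rowStochastic hP s)
    fun s' => norm_gUpdate_le hΦ hR hw hθ s s'

theorem norm_gMean_sub_le (hP : P ∈ rowStochastic ℝ S) (hΦ : ∀ s, ‖feature Φ s‖ ≤ 1)
    (hR : ∀ s, |R s| ≤ r) {w w' θ θ' : EuclideanSpace ℝ (Fin d)} (hw : ‖w‖ ≤ 1)
    (hθ' : ‖θ'‖ ≤ ϱ) (s : S) :
    ‖gMean P Φ R s w θ - gMean P Φ R s w' θ'‖ ≤ 3 * ‖θ - θ'‖ + (r + ϱ) * ‖w - w'‖ := by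
  simp only [gMean, ← Finset.sum_sub_distrib, ← smul_sub]
  exact norm_sum_smul_le_of_forall_le (fun s' => hP.1 s s') (sum_row_of_mem_rowStochastic hP s)
    fun s' => norm_gUpdate_sub_le hΦ hR hw hθ' s s'

/-- Exhibits `gBar` as an average over states and successors, so bounds on `gUpdate` pass to it
unchanged. -/
theorem gBar_eq_sum (hP : P ∈ rowStochastic ℝ S) (w θ : EuclideanSpace ℝ (Fin d)) :
    gBar P μ Φ R w θ = ∑ s, μ s • gMean P Φ R s w θ := by
  have hg : ∀ s, gMean P Φ R s w θ
      = (R s + (P *ᵥ (Φ *ᵥ θ.ofLp)) s - (Φ *ᵥ θ.ofLp) s) • feature Φ s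
        - (R s + (Φ *ᵥ θ.ofLp) s) • w := by
    intro s
    simp only [gMean, gUpdate, inner_feature, smul_sub, smul_smul, Finset.sum_sub_distrib,
      ← Finset.sum_smul]
    congr 2
    · simp only [mul_sub, mul_add, Finset.sum_sub_distrib, Finset.sum_add_distrib,
        ← Finset.sum_mul, sum_row_of_mem_rowStochastic hP, one_mul]
      rfl
    · rw [← Finset.sum_mul, sum_row_of_mem_rowStochastic hP, one_mul]
  simp_rw [hg]
  have hmul : ∀ (v : S → ℝ) (i : Fin d), (Φᵀ *ᵥ v) i = ∑ s, feature Φ s i * v s :=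
    fun _ _ => rfl
  ext i
  simp only [gBar, PiLp.sub_apply, PiLp.smul_apply, smul_eq_mul, WithLp.ofLp_sum,
    Finset.sum_apply, WithLp.ofLp_smul, WithLp.ofLp_sub, Pi.sub_apply, Pi.smul_apply,
    mul_sub (μ _), Finset.sum_sub_distrib]
  congr 1
  · rw [hmul]
    refine Finset.sum_congr rfl fun s _ => ?_
    rw [mulVec_diagonal, Pi.sub_apply, Pi.add_apply]
    ring
  · simp only [dotProduct, Pi.add_apply, Finset.sum_mul]
    exact Finset.sum_congr rfl fun s _ => by ring

theorem norm_gBar_le (hP : P ∈ rowStochastic ℝ S) (hμ : IsStationary P μ)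
    (hΦ : ∀ s, ‖feature Φ s‖ ≤ 1) (hR : ∀ s, |R s| ≤ r) {w θ : EuclideanSpace ℝ (Fin d)}
    (hw : ‖w‖ ≤ 1) (hθ : ‖θ‖ ≤ ϱ) : ‖gBar P μ Φ R w θ‖ ≤ 2 * r + 3 * ϱ := by
  rw [gBar_eq_sum hP]
  exact norm_sum_smul_le_of_forall_le hμ.nonneg hμ.sum_one
    fun s => norm_gMean_le hP hΦ hR hw hθ s

theorem norm_gBar_sub_le (hP : P ∈ rowStochastic ℝ S) (hμ : IsStationary P μ)
    (hΦ : ∀ s, ‖feature Φ s‖ ≤ 1) (hR : ∀ s, |R s| ≤ r)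
    {w w' θ θ' : EuclideanSpace ℝ (Fin d)} (hw : ‖w‖ ≤ 1) (hθ' : ‖θ'‖ ≤ ϱ) :
    ‖gBar P μ Φ R w θ - gBar P μ Φ R w' θ'‖ ≤ 3 * ‖θ - θ'‖ + (r + ϱ) * ‖w - w'‖ := by
  simp only [gBar_eq_sum hP, ← Finset.sum_sub_distrib, ← smul_sub]
  exact norm_sum_smul_le_of_forall_le hμ.nonneg hμ.sum_one
    fun s => norm_gMean_sub_le hP hΦ hR hw hθ' s

omit [DecidableEq S] in
theorem wStar_eq_sum : wStar Φ μ = ∑ s, μ s • feature Φ s := by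
  ext i
  simp [wStar, feature, mulVec, dotProduct, mul_comm]

omit [DecidableEq S] in
theorem norm_wStar_le (hμ : IsStationary P μ) (hΦ : ∀ s, ‖feature Φ s‖ ≤ 1) :
    ‖wStar Φ μ‖ ≤ 1 := by
  rw [wStar_eq_sum]
  exact norm_sum_smul_le_of_forall_le hμ.nonneg hμ.sum_one hΦ

theorem gBar_eq_add_smul (w w' θ : EuclideanSpace ℝ (Fin d)) :
    gBar P μ Φ R w θ = gBar P μ Φ R w' θ - (μ ⬝ᵥ (R + Φ *ᵥ θ.ofLp)) • (w - w') := by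
  simp only [gBar]
  module

omit [DecidableEq S] in
theorem abs_dotProduct_add_mulVec_le (hμ : IsStationary P μ) (hΦ : ∀ s, ‖feature Φ s‖ ≤ 1)
    (hR : ∀ s, |R s| ≤ r) {θ : EuclideanSpace ℝ (Fin d)} (hθ : ‖θ‖ ≤ ϱ) :
    |μ ⬝ᵥ (R + Φ *ᵥ θ.ofLp)| ≤ r + ϱ := by
  refine norm_sum_smul_le_of_forall_le (E := ℝ) hμ.nonneg hμ.sum_one fun s => ?_
  rw [Pi.add_apply, ← inner_feature]
  exact (abs_add_le _ _).trans
    (add_le_add (hR s) ((abs_inner_feature_le hΦ s θ).trans hθ))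

end Update

/-! ### Negative drift of the stationary mean update -/

section Drift

variable {S : Type*} [Fintype S] [DecidableEq S] {d : ℕ} {Φ : Matrix S (Fin d) ℝ}
  {R : S → ℝ} {P : Matrix S S ℝ} {μ : S → ℝ}

/-- In the expanded square, both pure terms equal ∑ μ f², one by the row sums and the other by
stationarity. Reversibility plays no role. -/
theorem dirichletSq_eq (hP : P ∈ rowStochastic ℝ S) (hμ : IsStationary P μ) (f : S → ℝ) :
    dirichletSq P μ f = ∑ s, μ s * (f s ^ 2 - f s * (P *ᵥ f) s) := by
  have h1 : ∑ s, ∑ s', μ s * P s s' * f s ^ 2 = ∑ s, μ s * f s ^ 2 := by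
    refine Finset.sum_congr rfl fun s _ => ?_
    rw [← Finset.sum_mul, ← Finset.mul_sum, sum_row_of_mem_rowStochastic hP, mul_one]
  have h2 : ∑ s, ∑ s', μ s * P s s' * f s' ^ 2 = ∑ s, μ s * f s ^ 2 := by
    rw [Finset.sum_comm]
    refine Finset.sum_congr rfl fun s' _ => ?_
    rw [← Finset.sum_mul]
    congr 1
    exact congrFun hμ.vecMul_eq s'
  have h3 : ∑ s, ∑ s', μ s * P s s' * (f s * f s') = ∑ s, μ s * (f s * (P *ᵥ f) s) := by
    refine Finset.sum_congr rfl fun s _ => ?_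
    rw [mulVec, dotProduct, Finset.mul_sum, Finset.mul_sum]
    exact Finset.sum_congr rfl fun s' _ => by ring
  have h4 : ∑ s, ∑ s', μ s * P s s' * (f s - f s') ^ 2
      = ∑ s, ∑ s', μ s * P s s' * f s ^ 2 + ∑ s, ∑ s', μ s * P s s' * f s' ^ 2
        - 2 * ∑ s, ∑ s', μ s * P s s' * (f s * f s') := by
    simp only [Finset.mul_sum, ← Finset.sum_add_distrib, ← Finset.sum_sub_distrib]
    exact Finset.sum_congr rfl fun s _ => Finset.sum_congr rfl fun s' _ => by ring
  rw [dirichletSq, h4, h1, h2, h3]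
  simp only [mul_sub, Finset.sum_sub_distrib]
  ring

theorem gBar_sub_gBar (w θ θ' : EuclideanSpace ℝ (Fin d)) :
    gBar P μ Φ R w θ - gBar P μ Φ R w θ' = gBar P μ Φ 0 w (θ - θ') := by
  ext i
  simp only [gBar, WithLp.ofLp_sub, mulVec_sub, mulVec_add, dotProduct_add, dotProduct_sub,
    zero_add, PiLp.sub_apply, PiLp.smul_apply, smul_eq_mul, Pi.sub_apply, Pi.add_apply]
  simp
  ring

/-- The choice w* = Φᵀμ gives ⟨e, w*⟩ = μᵀΦe, so the average-reward term contributes exactly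
−(μᵀΦe)²; the temporal difference contributes the Dirichlet part. -/
theorem inner_gBar_zero_wStar (hP : P ∈ rowStochastic ℝ S) (hμ : IsStationary P μ)
    (e : EuclideanSpace ℝ (Fin d)) :
    inner ℝ e (gBar P μ Φ 0 (wStar Φ μ) e)
      = -(dirichletSq P μ (Φ *ᵥ e.ofLp) + (μ ⬝ᵥ (Φ *ᵥ e.ofLp)) ^ 2) := by
  have hw : inner ℝ e (wStar Φ μ) = μ ⬝ᵥ (Φ *ᵥ e.ofLp) := by
    rw [wStar_eq_sum, inner_sum]
    refine Finset.sum_congr rfl fun s _ => ?_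
    rw [inner_smul_right, real_inner_comm, inner_feature]
  have h1 : inner ℝ e (WithLp.toLp 2 (Φᵀ *ᵥ (diagonal μ *ᵥ (P *ᵥ (Φ *ᵥ e.ofLp) - Φ *ᵥ e.ofLp))))
      = ∑ s, μ s * ((Φ *ᵥ e.ofLp) s * ((P *ᵥ (Φ *ᵥ e.ofLp)) s - (Φ *ᵥ e.ofLp) s)) := by
    rw [EuclideanSpace.inner_eq_star_dotProduct]
    simp only [star_trivial]
    rw [mulVec_transpose, ← dotProduct_mulVec]
    refine Finset.sum_congr rfl fun s _ => ?_
    rw [mulVec_diagonal, Pi.sub_apply]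
    ring
  simp only [gBar, zero_add, inner_sub_right, inner_smul_right, hw, h1, dirichletSq_eq hP hμ]
  rw [neg_add, ← Finset.sum_neg_distrib, sub_eq_add_neg]
  congr 1
  · exact Finset.sum_congr rfl fun s _ => by ring
  · ring

theorem dirichletSq_nonneg (hP : P ∈ rowStochastic ℝ S) (hμ : IsStationary P μ) (f : S → ℝ) :
    0 ≤ dirichletSq P μ f :=
  mul_nonneg (by norm_num) (Finset.sum_nonneg fun s _ => Finset.sum_nonneg fun s' _ =>
    mul_nonneg (mul_nonneg (hμ.nonneg s) (hP.1 s s')) (sq_nonneg _))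

theorem eta_mul_norm_sq_le (hP : P ∈ rowStochastic ℝ S) (hμ : IsStationary P μ)
    (e : EuclideanSpace ℝ (Fin d)) :
    eta P μ Φ * ‖e‖ ^ 2 ≤ dirichletSq P μ (Φ *ᵥ e.ofLp) + (μ ⬝ᵥ (Φ *ᵥ e.ofLp)) ^ 2 := by
  rcases eq_or_ne e 0 with rfl | he
  · have := dirichletSq_nonneg hP hμ (Φ *ᵥ (0 : EuclideanSpace ℝ (Fin d)).ofLp)
    rw [norm_zero, zero_pow two_ne_zero, mul_zero]
    exact add_nonneg this (sq_nonneg _)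
  have hn : 0 < ‖e‖ := norm_pos_iff.2 he
  have h := csInf_le (s := (fun x : EuclideanSpace ℝ (Fin d) =>
    dirichletSq P μ (Φ *ᵥ x.ofLp) + (μ ⬝ᵥ (Φ *ᵥ x.ofLp)) ^ 2) '' Metric.sphere 0 1)
    ⟨0, by
      rintro _ ⟨x, -, rfl⟩
      have := dirichletSq_nonneg hP hμ (Φ *ᵥ x.ofLp)
      positivity⟩ ⟨‖e‖⁻¹ • e, by simp [norm_smul, hn.ne'], rfl⟩
  have hd : dirichletSq P μ (Φ *ᵥ (‖e‖⁻¹ • e).ofLp)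
      = (‖e‖⁻¹) ^ 2 * dirichletSq P μ (Φ *ᵥ e.ofLp) := by
    simp only [dirichletSq, WithLp.ofLp_smul, mulVec_smul, Pi.smul_apply, smul_eq_mul,
      Finset.mul_sum]
    exact Finset.sum_congr rfl fun s _ => Finset.sum_congr rfl fun s' _ => by ring
  simp only [hd] at h
  rw [WithLp.ofLp_smul, mulVec_smul, dotProduct_smul, smul_eq_mul, mul_pow, ← mul_add] at h
  calc eta P μ Φ * ‖e‖ ^ 2 ≤ _ := mul_le_mul_of_nonneg_right h (sq_nonneg _)
    _ = _ := by field_simp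

/-- On the unit sphere |Φx| ≤ 1 entrywise, so the Dirichlet part is at most 2 and the squared mean
at most 1. This serves the case of large α. -/
theorem eta_le_three (hP : P ∈ rowStochastic ℝ S) (hμ : IsStationary P μ)
    (hΦ : ∀ s, ‖feature Φ s‖ ≤ 1) : eta P μ Φ ≤ 3 := by
  by_cases hne : ∃ x : EuclideanSpace ℝ (Fin d), ‖x‖ = 1
  · obtain ⟨x, hx⟩ := hne
    have h := eta_mul_norm_sq_le (Φ := Φ) hP hμ x
    have hf : ∀ s, |(Φ *ᵥ x.ofLp) s| ≤ 1 := fun s => by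
      rw [← inner_feature, ← hx]
      exact abs_inner_feature_le hΦ s x
    have hm : |μ ⬝ᵥ (Φ *ᵥ x.ofLp)| ≤ 1 :=
      norm_sum_smul_le_of_forall_le (E := ℝ) hμ.nonneg hμ.sum_one hf
    have hd : dirichletSq P μ (Φ *ᵥ x.ofLp) ≤ 1 / 2 * ∑ s, ∑ s', μ s * P s s' * 4 := by
      refine mul_le_mul_of_nonneg_left (Finset.sum_le_sum fun s _ => Finset.sum_le_sum
        fun s' _ => mul_le_mul_of_nonneg_left ?_ (mul_nonneg (hμ.nonneg s) (hP.1 s s')))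
        (by norm_num)
      have h1 := abs_le.1 (hf s)
      have h2 := abs_le.1 (hf s')
      nlinarith
    have hs : ∑ s, ∑ s', μ s * P s s' * 4 = 4 := by
      simp_rw [← Finset.sum_mul, ← Finset.mul_sum, sum_row_of_mem_rowStochastic hP, mul_one,
        hμ.sum_one, one_mul]
    rw [hx] at h
    have := sq_le_one_iff_abs_le_one (μ ⬝ᵥ (Φ *ᵥ x.ofLp)) |>.2 hm
    linarith
  -- For d = 0 the sphere is empty and `sInf` takes the default value 0.
  · have : Metric.sphere (0 : EuclideanSpace ℝ (Fin d)) 1 = ∅ := by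
      ext x
      simpa using fun h => hne ⟨x, h⟩
    simp [eta, this]

end Drift

/-- A row-stochastic matrix with a stationary distribution, features in the unit ball and rewards
bounded by `r`. -/
structure IsBoundedModel {S : Type*} [Fintype S] [DecidableEq S] {d : ℕ} (P : Matrix S S ℝ)
    (μ : S → ℝ) (Φ : Matrix S (Fin d) ℝ) (R : S → ℝ) (r : ℝ) : Prop where
  stochastic : P ∈ rowStochastic ℝ S
  stationary : IsStationary P μ
  norm_feature_le : ∀ s, ‖feature Φ s‖ ≤ 1
  abs_reward_le : ∀ s, |R s| ≤ r
  bound_nonneg : 0 ≤ r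

/-! ### Pathwise behaviour of the iterates -/

section Trajectory

variable {S : Type*} {d : ℕ} {Φ : Matrix S (Fin d) ℝ} {R : S → ℝ} {α β Rw ϱ r : ℝ}
  {w₀ θ₀ θstar : EuclideanSpace ℝ (Fin d)}

local notation "𝒵" => singleChain Φ R α β Rw ϱ w₀ θ₀

theorem dependsUpTo_singleChain (t : ℕ) : DependsUpTo t fun x => 𝒵 x t := by
  induction t with
  | zero => exact fun _ _ _ => rfl
  | succ t ih =>
    intro x y hxy
    have h : 𝒵 x t = 𝒵 y t := ih x y fun i hi => hxy i (by omega)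
    simp only [singleChain, h, hxy t (by omega), hxy (t + 1) le_rfl]

theorem norm_add_smul_sub_le {E : Type*} [SeminormedAddCommGroup E] [NormedSpace ℝ E]
    (hβ : 0 ≤ β) (hβ1 : β ≤ 1) {w v : E} (hw : ‖w‖ ≤ 1) (hv : ‖v‖ ≤ 1) :
    ‖w + β • (v - w)‖ ≤ 1 := by
  rw [show w + β • (v - w) = (1 - β) • w + β • v by module]
  refine (norm_add_le _ _).trans ?_
  rw [norm_smul, norm_smul, Real.norm_of_nonneg hβ, Real.norm_of_nonneg (sub_nonneg.2 hβ1)]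
  nlinarith

/-- For β ≤ 1 each step is a convex combination inside the unit ball, so as R_w ≥ 1 the projection
of `w` never acts. -/
theorem norm_singleChain_fst_le (hΦ : ∀ s, ‖feature Φ s‖ ≤ 1) (hβ : 0 ≤ β) (hβ1 : β ≤ 1)
    (hRw : 1 ≤ Rw) (hw₀ : ‖w₀‖ ≤ 1) (x : ℕ → S) (t : ℕ) : ‖(𝒵 x t).1‖ ≤ 1 := by
  induction t with
  | zero => exact hw₀
  | succ t ih =>
    have h := norm_add_smul_sub_le hβ hβ1 ih (hΦ (x t))
    have h' : (𝒵 x (t + 1)).1 = (𝒵 x t).1 + β • (feature Φ (x t) - (𝒵 x t).1) :=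
      projBall_of_norm_le (h.trans hRw)
    rwa [h']

theorem singleChain_fst_succ (hΦ : ∀ s, ‖feature Φ s‖ ≤ 1) (hβ : 0 ≤ β) (hβ1 : β ≤ 1)
    (hRw : 1 ≤ Rw) (hw₀ : ‖w₀‖ ≤ 1) (x : ℕ → S) (t : ℕ) :
    (𝒵 x (t + 1)).1 = (𝒵 x t).1 + β • (feature Φ (x t) - (𝒵 x t).1) :=
  projBall_of_norm_le ((norm_add_smul_sub_le hβ hβ1
    (norm_singleChain_fst_le hΦ hβ hβ1 hRw hw₀ x t) (hΦ (x t))).trans hRw)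

theorem norm_singleChain_snd_le (hϱ : 0 ≤ ϱ) (hθ₀ : ‖θ₀‖ ≤ ϱ) (x : ℕ → S) (t : ℕ) :
    ‖(𝒵 x t).2‖ ≤ ϱ := by
  cases t with
  | zero => exact hθ₀
  | succ t => exact norm_projBall_le hϱ

theorem norm_singleChain_fst_sub_le (hΦ : ∀ s, ‖feature Φ s‖ ≤ 1) (hβ : 0 ≤ β) (hβ1 : β ≤ 1)
    (hRw : 1 ≤ Rw) (hw₀ : ‖w₀‖ ≤ 1) (x : ℕ → S) (t k : ℕ) :
    ‖(𝒵 x (t + k)).1 - (𝒵 x t).1‖ ≤ 2 * β * k := by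
  induction k with
  | zero => simp
  | succ k ih =>
    rw [← add_assoc, singleChain_fst_succ hΦ hβ hβ1 hRw hw₀, add_sub_right_comm]
    have h1 := norm_singleChain_fst_le (R := R) (α := α) (ϱ := ϱ) (θ₀ := θ₀)
      hΦ hβ hβ1 hRw hw₀ x (t + k)
    have h2 := norm_sub_le (feature Φ (x (t + k))) (𝒵 x (t + k)).1
    refine (norm_add_le _ _).trans ?_
    rw [norm_smul, Real.norm_of_nonneg hβ]
    push_cast
    nlinarith [hΦ (x (t + k))]

theorem norm_singleChain_snd_sub_le (hΦ : ∀ s, ‖feature Φ s‖ ≤ 1) (hR : ∀ s, |R s| ≤ r)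
    (hα : 0 ≤ α) (hβ : 0 ≤ β) (hβ1 : β ≤ 1) (hRw : 1 ≤ Rw) (hw₀ : ‖w₀‖ ≤ 1) (hϱ : 0 ≤ ϱ)
    (hθ₀ : ‖θ₀‖ ≤ ϱ) (x : ℕ → S) (t k : ℕ) :
    ‖(𝒵 x (t + k)).2 - (𝒵 x t).2‖ ≤ α * (2 * r + 3 * ϱ) * k := by
  induction k with
  | zero => simp
  | succ k ih =>
    have hθ := norm_singleChain_snd_le (Φ := Φ) (R := R) (α := α) (β := β) (Rw := Rw) (w₀ := w₀)
      hϱ hθ₀ x (t + k)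
    have h1 : ‖(𝒵 x (t + k + 1)).2 - (𝒵 x (t + k)).2‖ ≤ α * (2 * r + 3 * ϱ) := by
      -- The previous iterate lies in the ball, so projecting does not lengthen the increment.
      refine (norm_projBall_sub_le hϱ hθ).trans ?_
      rw [add_sub_cancel_left, norm_smul, Real.norm_of_nonneg hα]
      exact mul_le_mul_of_nonneg_left (norm_gUpdate_le hΦ hR
        (norm_singleChain_fst_le hΦ hβ hβ1 hRw hw₀ x _) hθ _ _) hα
    have h2 := norm_sub_le_norm_sub_add_norm_sub (𝒵 x (t + k + 1)).2 (𝒵 x (t + k)).2 (𝒵 x t).2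
    rw [← add_assoc]
    push_cast
    linarith

theorem norm_singleChain_snd_succ_sub_sq_le (hϱ : 0 ≤ ϱ) (hθstar : ‖θstar‖ ≤ ϱ) (x : ℕ → S)
    (t : ℕ) : ‖(𝒵 x (t + 1)).2 - θstar‖ ^ 2 ≤ ‖(𝒵 x t).2 - θstar‖ ^ 2
      + 2 * α * inner ℝ ((𝒵 x t).2 - θstar)
        (gUpdate Φ R (x t) (x (t + 1)) (𝒵 x t).1 (𝒵 x t).2)
      + α ^ 2 * ‖gUpdate Φ R (x t) (x (t + 1)) (𝒵 x t).1 (𝒵 x t).2‖ ^ 2 := by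
  have h : ‖(𝒵 x (t + 1)).2 - θstar‖ ≤ _ := norm_projBall_sub_le hϱ hθstar
  refine (pow_le_pow_left₀ (norm_nonneg _) h 2).trans_eq ?_
  rw [add_sub_right_comm, norm_add_sq_real, inner_smul_right, norm_smul, mul_pow,
    Real.norm_eq_abs, sq_abs]
  ring

theorem norm_add_smul_sub_sub_sq {E : Type*} [NormedAddCommGroup E] [InnerProductSpace ℝ E]
    (w v u : E) : ‖w + β • (v - w) - u‖ ^ 2 = (1 - β) ^ 2 * ‖w - u‖ ^ 2
      + 2 * β * (1 - β) * inner ℝ (w - u) (v - u) + β ^ 2 * ‖v - u‖ ^ 2 := by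
  rw [show w + β • (v - w) - u = (1 - β) • (w - u) + β • (v - u) by module, norm_add_sq_real,
    inner_smul_left, inner_smul_right, norm_smul, norm_smul, mul_pow, mul_pow,
    Real.norm_eq_abs, Real.norm_eq_abs, sq_abs, sq_abs]
  simp only [conj_trivial]
  ring

end Trajectory

/-! ### Drift away from w*, and the Markovian bias -/

section Noise

variable {S : Type*} [Fintype S] [DecidableEq S] {d : ℕ} {Φ : Matrix S (Fin d) ℝ} {R : S → ℝ}
  {P : Matrix S S ℝ} {μ : S → ℝ} {r ϱ lam : ℝ} {θstar : EuclideanSpace ℝ (Fin d)}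

/-- Kept apart from its Young form because one case of the single-state argument needs the product
of the two errors itself. -/
theorem inner_gBar_le_add_mul (h : IsBoundedModel P μ Φ R r)
    (hθstar : gBar P μ Φ R (wStar Φ μ) θstar = 0) (hϱ : 0 ≤ ϱ)
    {w θ : EuclideanSpace ℝ (Fin d)} (hθ : ‖θ‖ ≤ ϱ) :
    inner ℝ (θ - θstar) (gBar P μ Φ R w θ)
      ≤ -(eta P μ Φ * ‖θ - θstar‖ ^ 2)
        + (r + 2 * ϱ) * (‖θ - θstar‖ * ‖w - wStar Φ μ‖) := by
  have h1 : gBar P μ Φ R w θ = gBar P μ Φ 0 (wStar Φ μ) (θ - θstar)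
      - (μ ⬝ᵥ (R + Φ *ᵥ θ.ofLp)) • (w - wStar Φ μ) := by
    rw [gBar_eq_add_smul w (wStar Φ μ), ← gBar_sub_gBar, hθstar, sub_zero]
  rw [h1, inner_sub_right, inner_smul_right, inner_gBar_zero_wStar h.stochastic h.stationary]
  have h2 := eta_mul_norm_sq_le (Φ := Φ) h.stochastic h.stationary (θ - θstar)
  have h3 : |(μ ⬝ᵥ (R + Φ *ᵥ θ.ofLp)) * inner ℝ (θ - θstar) (w - wStar Φ μ)|
      ≤ (r + 2 * ϱ) * (‖θ - θstar‖ * ‖w - wStar Φ μ‖) := by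
    rw [abs_mul]
    exact mul_le_mul ((abs_dotProduct_add_mulVec_le h.stationary h.norm_feature_le
      h.abs_reward_le hθ).trans (by linarith)) (abs_real_inner_le_norm _ _) (abs_nonneg _)
      (by linarith [h.bound_nonneg])
  have h4 := neg_le_abs ((μ ⬝ᵥ (R + Φ *ᵥ θ.ofLp)) * inner ℝ (θ - θstar) (w - wStar Φ μ))
  linarith

theorem inner_gBar_le (h : IsBoundedModel P μ Φ R r)
    (hθstar : gBar P μ Φ R (wStar Φ μ) θstar = 0) (hlam : 0 < lam) (hϱ : 0 ≤ ϱ)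
    {w θ : EuclideanSpace ℝ (Fin d)} (hθ : ‖θ‖ ≤ ϱ) :
    inner ℝ (θ - θstar) (gBar P μ Φ R w θ)
      ≤ -((eta P μ Φ - lam ^ 2 * (r + 2 * ϱ) / 2) * ‖θ - θstar‖ ^ 2)
        + (r + 2 * ϱ) / (2 * lam ^ 2) * ‖w - wStar Φ μ‖ ^ 2 := by
  have h1 := inner_gBar_le_add_mul h hθstar hϱ (w := w) hθ
  have h4 : ‖θ - θstar‖ * ‖w - wStar Φ μ‖
      ≤ lam ^ 2 / 2 * ‖θ - θstar‖ ^ 2 + 1 / (2 * lam ^ 2) * ‖w - wStar Φ μ‖ ^ 2 := by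
    have := sq_nonneg (lam * ‖θ - θstar‖ - lam⁻¹ * ‖w - wStar Φ μ‖)
    have h5 : lam ^ 2 / 2 * ‖θ - θstar‖ ^ 2 + 1 / (2 * lam ^ 2) * ‖w - wStar Φ μ‖ ^ 2
        - ‖θ - θstar‖ * ‖w - wStar Φ μ‖
        = (lam * ‖θ - θstar‖ - lam⁻¹ * ‖w - wStar Φ μ‖) ^ 2 / 2 := by
      field_simp
      ring
    linarith
  have h6 := mul_le_mul_of_nonneg_left h4 (show 0 ≤ r + 2 * ϱ by linarith [h.bound_nonneg])
  have h7 : (r + 2 * ϱ) / (2 * lam ^ 2) * ‖w - wStar Φ μ‖ ^ 2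
      = (r + 2 * ϱ) * (1 / (2 * lam ^ 2) * ‖w - wStar Φ μ‖ ^ 2) := by ring
  rw [h7]
  linarith

/-- The bias of the update of `θ` caused by the current state not being stationary. -/
noncomputable def tdNoise (P : Matrix S S ℝ) (μ : S → ℝ) (Φ : Matrix S (Fin d) ℝ) (R : S → ℝ)
    (θstar : EuclideanSpace ℝ (Fin d)) (s : S) (w θ : EuclideanSpace ℝ (Fin d)) : ℝ :=
  inner ℝ (θ - θstar) (gMean P Φ R s w θ - gBar P μ Φ R w θ)

theorem sum_mul_tdNoise (h : IsBoundedModel P μ Φ R r) (w θ : EuclideanSpace ℝ (Fin d)) :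
    ∑ s, μ s * tdNoise P μ Φ R θstar s w θ = 0 := by
  simp only [tdNoise, inner_sub_right, mul_sub, Finset.sum_sub_distrib, ← Finset.sum_mul,
    h.stationary.sum_one, gBar_eq_sum h.stochastic, inner_sum, inner_smul_right]
  ring

theorem norm_gMean_sub_gBar_le (h : IsBoundedModel P μ Φ R r) {w θ : EuclideanSpace ℝ (Fin d)}
    (hw : ‖w‖ ≤ 1) (hθ : ‖θ‖ ≤ ϱ) (s : S) :
    ‖gMean P Φ R s w θ - gBar P μ Φ R w θ‖ ≤ 2 * (2 * r + 3 * ϱ) := by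
  have h1 := norm_gMean_le h.stochastic h.norm_feature_le h.abs_reward_le hw hθ s
  have h2 := norm_gBar_le h.stochastic h.stationary h.norm_feature_le h.abs_reward_le hw hθ
  linarith [norm_sub_le (gMean P Φ R s w θ) (gBar P μ Φ R w θ)]

theorem abs_tdNoise_le (h : IsBoundedModel P μ Φ R r) (hϱ : 0 ≤ ϱ) (hθstar : ‖θstar‖ ≤ ϱ)
    {w θ : EuclideanSpace ℝ (Fin d)} (hw : ‖w‖ ≤ 1) (hθ : ‖θ‖ ≤ ϱ) (s : S) :
    |tdNoise P μ Φ R θstar s w θ| ≤ 2 * ϱ * (2 * (2 * r + 3 * ϱ)) :=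
  (abs_real_inner_le_norm _ _).trans (mul_le_mul
    ((norm_sub_le _ _).trans (by linarith)) (norm_gMean_sub_gBar_le h hw hθ s)
    (norm_nonneg _) (by positivity))

/-- The constant 4r + 18ϱ is 2(2r + 3ϱ) from moving the left factor of the inner product plus 2ϱ · 6
from the two 3-Lipschitz means. -/
theorem tdNoise_sub_le (h : IsBoundedModel P μ Φ R r) (hϱ : 0 ≤ ϱ) (hθstar : ‖θstar‖ ≤ ϱ)
    {w w' θ θ' : EuclideanSpace ℝ (Fin d)} (hw : ‖w‖ ≤ 1) (hθ : ‖θ‖ ≤ ϱ)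
    (hθ' : ‖θ'‖ ≤ ϱ) (s : S) :
    tdNoise P μ Φ R θstar s w θ - tdNoise P μ Φ R θstar s w' θ'
      ≤ (4 * r + 18 * ϱ) * ‖θ - θ'‖ + 4 * ϱ * (r + ϱ) * ‖w - w'‖ := by
  have h0 : tdNoise P μ Φ R θstar s w θ - tdNoise P μ Φ R θstar s w' θ'
      = inner ℝ (θ - θ') (gMean P Φ R s w θ - gBar P μ Φ R w θ)
        + inner ℝ (θ' - θstar) ((gMean P Φ R s w θ - gMean P Φ R s w' θ')
          - (gBar P μ Φ R w θ - gBar P μ Φ R w' θ')) := by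
    simp only [tdNoise, inner_sub_right, inner_sub_left]
    ring
  have h1 := (real_inner_le_norm (θ - θ') (gMean P Φ R s w θ - gBar P μ Φ R w θ)).trans
    (mul_le_mul_of_nonneg_left (norm_gMean_sub_gBar_le h hw hθ s) (norm_nonneg _))
  have h2 := norm_gMean_sub_le h.stochastic h.norm_feature_le h.abs_reward_le (w' := w') hw
    (θ := θ) hθ' s
  have h3 := norm_gBar_sub_le h.stochastic h.stationary h.norm_feature_le h.abs_reward_le
    (w' := w') hw (θ := θ) hθ'
  have h4 := (norm_sub_le (gMean P Φ R s w θ - gMean P Φ R s w' θ')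
    (gBar P μ Φ R w θ - gBar P μ Φ R w' θ')).trans (add_le_add h2 h3)
  have h5 : ‖θ' - θstar‖ ≤ 2 * ϱ := (norm_sub_le _ _).trans (by linarith)
  have h6 := (real_inner_le_norm (θ' - θstar) ((gMean P Φ R s w θ - gMean P Φ R s w' θ')
    - (gBar P μ Φ R w θ - gBar P μ Φ R w' θ'))).trans
    (mul_le_mul h5 h4 (norm_nonneg _) (by positivity))
  rw [h0]
  linarith

end Noise

theorem integral_mul_add_mul_add_const {Ω : Type*} [MeasurableSpace Ω] {ℙ : Measure Ω}
    [IsProbabilityMeasure ℙ] {f g : Ω → ℝ} (hf : Integrable f ℙ) (hg : Integrable g ℙ)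
    (a b c : ℝ) : Integrable (fun ω => a * f ω + b * g ω + c) ℙ ∧
      ∫ ω, (a * f ω + b * g ω + c) ∂ℙ = a * ∫ ω, f ω ∂ℙ + b * ∫ ω, g ω ∂ℙ + c := by
  have h := (hf.const_mul a).add (hg.const_mul b)
  refine ⟨h.add (integrable_const c), ?_⟩
  rw [integral_add (f := fun ω => a * f ω + b * g ω) h (integrable_const c),
    integral_add (hf.const_mul a) (hg.const_mul b), integral_const_mul, integral_const_mul,
    integral_const, probReal_univ, one_smul]

/-! ### Mean-square estimates under Markovian sampling -/

section MeanSquare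

variable {S : Type*} [Fintype S] [DecidableEq S] {Ω : Type*} [MeasurableSpace Ω]
  {ℙ : Measure Ω} [IsProbabilityMeasure ℙ] {d : ℕ} {Φ : Matrix S (Fin d) ℝ} {R : S → ℝ}
  {P : Matrix S S ℝ} {μ : S → ℝ} {X : ℕ → Ω → S} {α β Rw ϱ r lam : ℝ}
  {w₀ θ₀ θstar : EuclideanSpace ℝ (Fin d)}

local notation "𝒵" => singleChain Φ R α β Rw ϱ w₀ θ₀

omit [Fintype S] [DecidableEq S] in
/-- A function of the states and iterates up to time `t`. -/
theorem dependsUpTo_comp_singleChain {E : Type*} (t : ℕ)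
    (f : S → EuclideanSpace ℝ (Fin d) × EuclideanSpace ℝ (Fin d) → E) :
    DependsUpTo t fun x : ℕ → S => f (x t) (𝒵 x t) := fun x y hxy => by
  have h : 𝒵 x t = 𝒵 y t := dependsUpTo_singleChain t x y hxy
  simp only [h, hxy t le_rfl]

/-- Integrating out the successor state turns `gUpdate` into `gMean` exactly, so mixing is needed
only for the current state. -/
theorem integral_inner_gUpdate (hX : IsMarkovChain ℙ P X) (t : ℕ) :
    ∫ ω, inner ℝ ((𝒵 (fun i => X i ω) t).2 - θstar) (gUpdate Φ R (X t ω) (X (t + 1) ω)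
        (𝒵 (fun i => X i ω) t).1 (𝒵 (fun i => X i ω) t).2) ∂ℙ
      = ∫ ω, inner ℝ ((𝒵 (fun i => X i ω) t).2 - θstar) (gBar P μ Φ R
          (𝒵 (fun i => X i ω) t).1 (𝒵 (fun i => X i ω) t).2) ∂ℙ
        + ∫ ω, tdNoise P μ Φ R θstar (X t ω) (𝒵 (fun i => X i ω) t).1
          (𝒵 (fun i => X i ω) t).2 ∂ℙ := by
  have h1 : ∀ s', DependsUpTo t fun x : ℕ → S => inner ℝ ((𝒵 x t).2 - θstar)
      (gUpdate Φ R (x t) s' (𝒵 x t).1 (𝒵 x t).2) := fun s' =>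
    dependsUpTo_comp_singleChain t fun s z => inner ℝ (z.2 - θstar) (gUpdate Φ R s s' z.1 z.2)
  have h2 : DependsUpTo t fun x : ℕ → S => inner ℝ ((𝒵 x t).2 - θstar)
      (gBar P μ Φ R (𝒵 x t).1 (𝒵 x t).2) :=
    dependsUpTo_comp_singleChain t fun _ z => inner ℝ (z.2 - θstar) (gBar P μ Φ R z.1 z.2)
  have h3 : DependsUpTo t fun x : ℕ → S => tdNoise P μ Φ R θstar (x t) (𝒵 x t).1 (𝒵 x t).2 :=
    dependsUpTo_comp_singleChain t fun s z => tdNoise P μ Φ R θstar s z.1 z.2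
  rw [← integral_add (h2.integrable hX) (h3.integrable hX)]
  refine (hX.integral_succ (H := fun s' x => inner ℝ ((𝒵 x t).2 - θstar)
      (gUpdate Φ R (x t) s' (𝒵 x t).1 (𝒵 x t).2)) h1).trans ?_
  congr 1
  funext ω
  simp only [tdNoise, gMean, inner_sub_right, inner_sum, inner_smul_right]
  ring

theorem integral_tdNoise_le (h : IsBoundedModel P μ Φ R r) (hX : IsMarkovChain ℙ P X)
    (hRw : 1 ≤ Rw) (hϱ : 0 ≤ ϱ) (hw₀ : ‖w₀‖ ≤ 1) (hθ₀ : ‖θ₀‖ ≤ ϱ) (hθstar : ‖θstar‖ ≤ ϱ)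
    (hα : 0 ≤ α) (hβ : 0 ≤ β) (hβ1 : β ≤ 1) (hβα : β ≤ α) {τ : ℕ} (hτ : 1 ≤ τ)
    (hmix : ∀ s, ∑ s', |(P ^ τ) s s' - μ s'| ≤ α) (k : ℕ) :
    ∫ ω, tdNoise P μ Φ R θstar (X (k + τ) ω) (𝒵 (fun i => X i ω) (k + τ)).1
      (𝒵 (fun i => X i ω) (k + τ)).2 ∂ℙ ≤ 44 * τ * α * (r + 3 * ϱ) ^ 2 := by
  have hr := h.bound_nonneg
  have hw : ∀ x t, ‖(𝒵 x t).1‖ ≤ 1 := fun x t =>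
    norm_singleChain_fst_le h.norm_feature_le hβ hβ1 hRw hw₀ x t
  have hθ : ∀ x t, ‖(𝒵 x t).2‖ ≤ ϱ := fun x t => norm_singleChain_snd_le hϱ hθ₀ x t
  have hdep : ∀ s, DependsUpTo k fun x : ℕ → S =>
      tdNoise P μ Φ R θstar s (𝒵 x k).1 (𝒵 x k).2 := fun s =>
    dependsUpTo_comp_singleChain k fun _ z => tdNoise P μ Φ R θstar s z.1 z.2
  have h1 := hX.integral_add_le (k := τ) hdep hmix
    (fun s x => abs_tdNoise_le h hϱ hθstar (hw x k) (hθ x k) s) (fun x => sum_mul_tdNoise h _ _)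
  set D := (4 * r + 18 * ϱ) * (α * (2 * r + 3 * ϱ) * τ) + 4 * ϱ * (r + ϱ) * (2 * β * τ) with hD
  have hint : DependsUpTo (k + τ) fun x : ℕ → S =>
      tdNoise P μ Φ R θstar (x (k + τ)) (𝒵 x (k + τ)).1 (𝒵 x (k + τ)).2 :=
    dependsUpTo_comp_singleChain _ fun s z => tdNoise P μ Φ R θstar s z.1 z.2
  have hint' : DependsUpTo (k + τ) fun x : ℕ → S =>
      tdNoise P μ Φ R θstar (x (k + τ)) (𝒵 x k).1 (𝒵 x k).2 := fun x y hxy => by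
    simp only [hxy _ le_rfl]
    exact hdep _ x y fun i hi => hxy i (by omega)
  have h2 : ∫ ω, tdNoise P μ Φ R θstar (X (k + τ) ω) (𝒵 (fun i => X i ω) (k + τ)).1
      (𝒵 (fun i => X i ω) (k + τ)).2 ∂ℙ
      ≤ ∫ ω, (tdNoise P μ Φ R θstar (X (k + τ) ω) (𝒵 (fun i => X i ω) k).1
        (𝒵 (fun i => X i ω) k).2 + D) ∂ℙ := by
    refine integral_mono (hint.integrable hX)
      ((hint'.integrable hX).add (integrable_const D)) fun ω => ?_
    have h3 := tdNoise_sub_le h hϱ hθstar (hw (fun i => X i ω) (k + τ))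
      (hθ (fun i => X i ω) (k + τ)) (hθ (fun i => X i ω) k) (w' := (𝒵 (fun i => X i ω) k).1)
      (X (k + τ) ω)
    have h4 := norm_singleChain_snd_sub_le h.norm_feature_le h.abs_reward_le hα hβ hβ1 hRw hw₀
      hϱ hθ₀ (fun i => X i ω) k τ
    have h5 := norm_singleChain_fst_sub_le (R := R) (α := α) (ϱ := ϱ) (θ₀ := θ₀)
      h.norm_feature_le hβ hβ1 hRw hw₀ (fun i => X i ω) k τ
    have h6 := mul_le_mul_of_nonneg_left h4 (show 0 ≤ 4 * r + 18 * ϱ by positivity)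
    have h7 := mul_le_mul_of_nonneg_left h5 (show 0 ≤ 4 * ϱ * (r + ϱ) by positivity)
    simp only [hD]
    linarith
  rw [integral_add (hint'.integrable hX) (integrable_const D), integral_const,
    probReal_univ, one_smul] at h2
  have hτ' : (1 : ℝ) ≤ τ := by exact_mod_cast hτ
  have h8 : 4 * ϱ * (r + ϱ) * (2 * β * τ) ≤ 4 * ϱ * (r + ϱ) * (2 * α * τ) := by gcongr
  -- The mixing error carries no factor τ; τ ≥ 1 is what lets it be absorbed.
  have h9 : α * (2 * ϱ * (2 * (2 * r + 3 * ϱ))) * 1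
      ≤ α * (2 * ϱ * (2 * (2 * r + 3 * ϱ))) * τ :=
    mul_le_mul_of_nonneg_left hτ' (by positivity)
  have h10 : 44 * τ * α * (r + 3 * ϱ) ^ 2 - (α * (2 * ϱ * (2 * (2 * r + 3 * ϱ))) * τ
      + (4 * r + 18 * ϱ) * (α * (2 * r + 3 * ϱ) * τ) + 4 * ϱ * (r + ϱ) * (2 * α * τ))
      = τ * α * (36 * r ^ 2 + 200 * r * ϱ + 322 * ϱ ^ 2) := by ring
  have h11 : 0 ≤ τ * α * (36 * r ^ 2 + 200 * r * ϱ + 322 * ϱ ^ 2) := by positivity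
  linarith

theorem integral_norm_fst_sub_sq_le (h : IsBoundedModel P μ Φ R r) (hX : IsMarkovChain ℙ P X)
    (hRw : 1 ≤ Rw) (hw₀ : ‖w₀‖ ≤ 1) (hβ : 0 ≤ β) (hβ1 : β ≤ 1) {τ : ℕ}
    (hmix : ∀ s, ∑ s', |(P ^ τ) s s' - μ s'| ≤ β) (k : ℕ) :
    ∫ ω, ‖(𝒵 (fun i => X i ω) (k + τ)).1 - wStar Φ μ‖ ^ 2 ∂ℙ
      ≤ 4 * ((1 - β) ^ 2) ^ k + β * (4 * τ + 6) := by
  have hw : ∀ x t, ‖(𝒵 x t).1‖ ≤ 1 := fun x t =>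
    norm_singleChain_fst_le h.norm_feature_le hβ hβ1 hRw hw₀ x t
  have hws := norm_wStar_le h.stationary h.norm_feature_le
  have hφ : ∀ s, ‖feature Φ s - wStar Φ μ‖ ≤ 2 := fun s =>
    (norm_sub_le _ _).trans (by linarith [h.norm_feature_le s])
  have hwd : ∀ x t, ‖(𝒵 x t).1 - wStar Φ μ‖ ≤ 2 := fun x t =>
    (norm_sub_le _ _).trans (by linarith [hw x t])
  have hdep : ∀ t, DependsUpTo t fun x : ℕ → S => ‖(𝒵 x t).1 - wStar Φ μ‖ ^ 2 := fun t =>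
    dependsUpTo_comp_singleChain t fun _ z => ‖z.1 - wStar Φ μ‖ ^ 2
  induction k with
  | zero =>
    have h1 : ∫ ω, ‖(𝒵 (fun i => X i ω) (0 + τ)).1 - wStar Φ μ‖ ^ 2 ∂ℙ ≤ ∫ _, (4 : ℝ) ∂ℙ :=
      integral_mono ((hdep _).integrable hX) (integrable_const _) fun ω => by
        have := hwd (fun i => X i ω) (0 + τ)
        have := norm_nonneg ((𝒵 (fun i => X i ω) (0 + τ)).1 - wStar Φ μ)
        dsimp only
        nlinarith
    rw [integral_const, probReal_univ, one_smul] at h1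
    have : 0 ≤ β * (4 * τ + 6) := by positivity
    rw [pow_zero]
    linarith
  | succ k ih =>
    have hH : ∀ s, DependsUpTo k fun x : ℕ → S =>
        inner ℝ ((𝒵 x k).1 - wStar Φ μ) (feature Φ s - wStar Φ μ) := fun s =>
      dependsUpTo_comp_singleChain k fun _ z => inner ℝ (z.1 - wStar Φ μ)
        (feature Φ s - wStar Φ μ)
    have h1 := hX.integral_add_le (k := τ) (C := 4) hH hmix
      (fun s x => (abs_real_inner_le_norm _ _).trans ((mul_le_mul (hwd x k) (hφ s)
        (norm_nonneg _) (by norm_num)).trans_eq (by norm_num))) (fun x => by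
        have : ∑ s, μ s • (feature Φ s - wStar Φ μ) = 0 := by
          simp only [smul_sub, Finset.sum_sub_distrib, ← Finset.sum_smul, h.stationary.sum_one,
            ← wStar_eq_sum, one_smul, sub_self]
        simp_rw [← inner_smul_right, ← inner_sum, this, inner_zero_right])
    have hint' : DependsUpTo (k + τ) fun x : ℕ → S =>
        inner ℝ ((𝒵 x k).1 - wStar Φ μ) (feature Φ (x (k + τ)) - wStar Φ μ) := fun x y hxy => by
      simp only [hxy _ le_rfl]
      exact hH _ x y fun i hi => hxy i (by omega)
    set c := 2 * β * (1 - β) * (4 * β * τ) + β ^ 2 * 4 with hc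
    have h2 : ∫ ω, ‖(𝒵 (fun i => X i ω) (k + τ + 1)).1 - wStar Φ μ‖ ^ 2 ∂ℙ
        ≤ ∫ ω, ((1 - β) ^ 2 * ‖(𝒵 (fun i => X i ω) (k + τ)).1 - wStar Φ μ‖ ^ 2
          + 2 * β * (1 - β) * inner ℝ ((𝒵 (fun i => X i ω) k).1 - wStar Φ μ)
            (feature Φ (X (k + τ) ω) - wStar Φ μ) + c) ∂ℙ := by
      refine integral_mono ((hdep _).integrable hX) (integral_mul_add_mul_add_const
        ((hdep _).integrable hX) (hint'.integrable hX) _ _ c).1 fun ω => ?_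
      dsimp only
      rw [singleChain_fst_succ h.norm_feature_le hβ hβ1 hRw hw₀, norm_add_smul_sub_sub_sq]
      set x : ℕ → S := fun i => X i ω
      have h3 := norm_singleChain_fst_sub_le (R := R) (α := α) (ϱ := ϱ) (θ₀ := θ₀)
        h.norm_feature_le hβ hβ1 hRw hw₀ x k τ
      have h4 : inner ℝ ((𝒵 x (k + τ)).1 - wStar Φ μ) (feature Φ (x (k + τ)) - wStar Φ μ)
          ≤ inner ℝ ((𝒵 x k).1 - wStar Φ μ) (feature Φ (x (k + τ)) - wStar Φ μ)
            + 4 * β * τ := by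
        have h5 : inner ℝ ((𝒵 x (k + τ)).1 - wStar Φ μ) (feature Φ (x (k + τ)) - wStar Φ μ)
            - inner ℝ ((𝒵 x k).1 - wStar Φ μ) (feature Φ (x (k + τ)) - wStar Φ μ)
            = inner ℝ ((𝒵 x (k + τ)).1 - (𝒵 x k).1) (feature Φ (x (k + τ)) - wStar Φ μ) := by
          rw [← inner_sub_left, sub_sub_sub_cancel_right]
        have h6 := (real_inner_le_norm ((𝒵 x (k + τ)).1 - (𝒵 x k).1)
          (feature Φ (x (k + τ)) - wStar Φ μ)).trans
          (mul_le_mul h3 (hφ _) (norm_nonneg _) (by positivity))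
        linarith
      have h7 := mul_le_mul_of_nonneg_left h4
        (show 0 ≤ 2 * β * (1 - β) from mul_nonneg (by positivity) (sub_nonneg.2 hβ1))
      have h8 : β ^ 2 * ‖feature Φ (x (k + τ)) - wStar Φ μ‖ ^ 2 ≤ β ^ 2 * 4 := by
        refine mul_le_mul_of_nonneg_left ?_ (sq_nonneg β)
        have := hφ (x (k + τ))
        have := norm_nonneg (feature Φ (x (k + τ)) - wStar Φ μ)
        nlinarith
      simp only [hc]
      linarith
    rw [(integral_mul_add_mul_add_const ((hdep _).integrable hX) (hint'.integrable hX) _ _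
      c).2] at h2
    rw [show k + 1 + τ = k + τ + 1 by ring]
    have h9 := mul_le_mul_of_nonneg_left ih (sq_nonneg (1 - β))
    have h10 := mul_le_mul_of_nonneg_left h1
      (show 0 ≤ 2 * β * (1 - β) from mul_nonneg (by positivity) (sub_nonneg.2 hβ1))
    -- The constant 4τ + 6 makes the β² terms cancel: 2(4τ + 6) = 8τ + 8 + 4, from freezing, mixing
    -- and the squared increment. A nonnegative cubic term is left.
    have h11 : β * (4 * τ + 6) - ((1 - β) ^ 2 * (β * (4 * τ + 6)) + 2 * β * (1 - β) * (β * 4) + c)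
        = β ^ 2 * (β * (4 * τ + 2)) := by
      rw [hc]
      ring
    have h12 : 0 ≤ β ^ 2 * (β * (4 * τ + 2)) := by positivity
    rw [pow_succ]
    linarith

/-- One step of the mean-square error recursion, before the errors are estimated. -/
theorem integral_norm_snd_succ_sub_sq_le (h : IsBoundedModel P μ Φ R r)
    (hX : IsMarkovChain ℙ P X) (hRw : 1 ≤ Rw) (hϱ : 0 ≤ ϱ) (hw₀ : ‖w₀‖ ≤ 1) (hθ₀ : ‖θ₀‖ ≤ ϱ)
    (hθstar : ‖θstar‖ ≤ ϱ) (hroot : gBar P μ Φ R (wStar Φ μ) θstar = 0) (hlam : 0 < lam)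
    (hα : 0 ≤ α) (hβ : 0 ≤ β) (hβ1 : β ≤ 1) (t : ℕ) :
    ∫ ω, ‖(𝒵 (fun i => X i ω) (t + 1)).2 - θstar‖ ^ 2 ∂ℙ
      ≤ (1 - 2 * α * (eta P μ Φ - lam ^ 2 * (r + 2 * ϱ) / 2))
          * ∫ ω, ‖(𝒵 (fun i => X i ω) t).2 - θstar‖ ^ 2 ∂ℙ
        + α * (r + 2 * ϱ) / lam ^ 2 * ∫ ω, ‖(𝒵 (fun i => X i ω) t).1 - wStar Φ μ‖ ^ 2 ∂ℙ
        + 2 * α * ∫ ω, tdNoise P μ Φ R θstar (X t ω) (𝒵 (fun i => X i ω) t).1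
            (𝒵 (fun i => X i ω) t).2 ∂ℙ
        + 4 * α ^ 2 * (r + 3 * ϱ) ^ 2 := by
  have hr := h.bound_nonneg
  have hw : ∀ x t, ‖(𝒵 x t).1‖ ≤ 1 := fun x t =>
    norm_singleChain_fst_le h.norm_feature_le hβ hβ1 hRw hw₀ x t
  have hθ : ∀ x t, ‖(𝒵 x t).2‖ ≤ ϱ := fun x t => norm_singleChain_snd_le hϱ hθ₀ x t
  have hE : ∀ t, Integrable (fun ω => ‖(𝒵 (fun i => X i ω) t).2 - θstar‖ ^ 2) ℙ := fun t =>
    (dependsUpTo_comp_singleChain t fun _ z => ‖z.2 - θstar‖ ^ 2).integrable hX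
  have hW : Integrable (fun ω => ‖(𝒵 (fun i => X i ω) t).1 - wStar Φ μ‖ ^ 2) ℙ :=
    (dependsUpTo_comp_singleChain t fun _ z => ‖z.1 - wStar Φ μ‖ ^ 2).integrable hX
  have hB : Integrable (fun ω => inner ℝ ((𝒵 (fun i => X i ω) t).2 - θstar)
      (gBar P μ Φ R (𝒵 (fun i => X i ω) t).1 (𝒵 (fun i => X i ω) t).2)) ℙ :=
    (dependsUpTo_comp_singleChain t fun _ z =>
      inner ℝ (z.2 - θstar) (gBar P μ Φ R z.1 z.2)).integrable hX
  have hG : Integrable (fun ω => inner ℝ ((𝒵 (fun i => X i ω) t).2 - θstar)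
      (gUpdate Φ R (X t ω) (X (t + 1) ω) (𝒵 (fun i => X i ω) t).1
        (𝒵 (fun i => X i ω) t).2)) ℙ := by
    have hdep : DependsUpTo (t + 1) fun x : ℕ → S => inner ℝ ((𝒵 x t).2 - θstar)
        (gUpdate Φ R (x t) (x (t + 1)) (𝒵 x t).1 (𝒵 x t).2) := fun x y hxy => by
      have h1 : 𝒵 x t = 𝒵 y t := dependsUpTo_singleChain t x y fun i hi => hxy i (by omega)
      simp only [h1, hxy t (by omega), hxy (t + 1) le_rfl]
    exact hdep.integrable hX
  set c := 4 * α ^ 2 * (r + 3 * ϱ) ^ 2 with hc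
  set ζ := eta P μ Φ - lam ^ 2 * (r + 2 * ϱ) / 2 with hζ
  have h1 : ∫ ω, ‖(𝒵 (fun i => X i ω) (t + 1)).2 - θstar‖ ^ 2 ∂ℙ
      ≤ ∫ ω, (1 * ‖(𝒵 (fun i => X i ω) t).2 - θstar‖ ^ 2
        + 2 * α * inner ℝ ((𝒵 (fun i => X i ω) t).2 - θstar)
          (gUpdate Φ R (X t ω) (X (t + 1) ω) (𝒵 (fun i => X i ω) t).1
            (𝒵 (fun i => X i ω) t).2) + c) ∂ℙ := by
    refine integral_mono (hE _) (integral_mul_add_mul_add_const (hE t) hG _ _ c).1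
      fun ω => (norm_singleChain_snd_succ_sub_sq_le hϱ hθstar (fun i => X i ω) t).trans ?_
    rw [one_mul]
    refine add_le_add le_rfl ?_
    have h2 := norm_gUpdate_le h.norm_feature_le h.abs_reward_le (hw (fun i => X i ω) t)
      (hθ (fun i => X i ω) t) (X t ω) (X (t + 1) ω)
    rw [hc, show 4 * α ^ 2 * (r + 3 * ϱ) ^ 2 = α ^ 2 * (2 * (r + 3 * ϱ)) ^ 2 by ring]
    exact mul_le_mul_of_nonneg_left
      (pow_le_pow_left₀ (norm_nonneg _) (h2.trans (by linarith)) 2) (sq_nonneg α)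
  rw [(integral_mul_add_mul_add_const (hE t) hG _ _ c).2,
    integral_inner_gUpdate (μ := μ) hX] at h1
  have h3 : ∫ ω, inner ℝ ((𝒵 (fun i => X i ω) t).2 - θstar)
      (gBar P μ Φ R (𝒵 (fun i => X i ω) t).1 (𝒵 (fun i => X i ω) t).2) ∂ℙ
      ≤ ∫ ω, (-ζ * ‖(𝒵 (fun i => X i ω) t).2 - θstar‖ ^ 2
        + (r + 2 * ϱ) / (2 * lam ^ 2) * ‖(𝒵 (fun i => X i ω) t).1 - wStar Φ μ‖ ^ 2) ∂ℙ :=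
    integral_mono hB (((hE t).const_mul _).add (hW.const_mul _)) fun ω => by
      have := inner_gBar_le h hroot hlam hϱ (w := (𝒵 (fun i => X i ω) t).1)
        (hθ (fun i => X i ω) t)
      rw [← neg_mul] at this
      exact this
  rw [integral_add ((hE t).const_mul _) (hW.const_mul _), integral_const_mul,
    integral_const_mul] at h3
  have h4 := mul_le_mul_of_nonneg_left h3 (show 0 ≤ 2 * α by positivity)
  have h5 : 2 * α * ((r + 2 * ϱ) / (2 * lam ^ 2)) = α * (r + 2 * ϱ) / lam ^ 2 := by
    field_simp
  rw [← h5]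
  linarith

end MeanSquare

/-! ### The noiseless case of a single state -/

section SingleState

variable {S : Type*} [Fintype S] [DecidableEq S] [Subsingleton S] {d : ℕ}
  {Φ : Matrix S (Fin d) ℝ} {R : S → ℝ} {P : Matrix S S ℝ} {μ : S → ℝ}
  {α β Rw ϱ r lam G : ℝ} {w₀ θ₀ θstar : EuclideanSpace ℝ (Fin d)}

local notation "𝒵" => singleChain Φ R α β Rw ϱ w₀ θ₀

omit [DecidableEq S] in
theorem wStar_eq_feature (hμ : IsStationary P μ) (s : S) : wStar Φ μ = feature Φ s := by
  have h := hμ.sum_one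
  rw [Fintype.sum_subsingleton _ s] at h
  rw [wStar_eq_sum, Fintype.sum_subsingleton _ s, h, one_smul]

theorem gUpdate_eq_gBar (h : IsBoundedModel P μ Φ R r) (s s' : S)
    (w θ : EuclideanSpace ℝ (Fin d)) : gUpdate Φ R s s' w θ = gBar P μ Φ R w θ := by
  have h1 := h.stationary.sum_one
  have h2 := sum_row_of_mem_rowStochastic h.stochastic s
  rw [Fintype.sum_subsingleton _ s] at h1 h2
  rw [gBar_eq_sum h.stochastic, Fintype.sum_subsingleton _ s, h1, one_smul, gMean,
    Fintype.sum_subsingleton _ s, h2, one_smul, Subsingleton.elim s' s]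

omit [Fintype S] [DecidableEq S] in
-- With s' = s the value difference cancels. The gap between 2r + ϱ and 2(r + 3ϱ) is slack spent in
-- the recursion.
theorem norm_gUpdate_le_of_subsingleton (hΦ : ∀ s, ‖feature Φ s‖ ≤ 1) (hR : ∀ s, |R s| ≤ r)
    {w θ : EuclideanSpace ℝ (Fin d)} (hw : ‖w‖ ≤ 1) (hθ : ‖θ‖ ≤ ϱ) (s s' : S) :
    ‖gUpdate Φ R s s' w θ‖ ≤ 2 * r + ϱ := by
  have h0 : gUpdate Φ R s s' w θ = R s • (feature Φ s - w) - inner ℝ (feature Φ s) θ • w := by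
    rw [Subsingleton.elim s' s, gUpdate]
    module
  rw [h0]
  refine (norm_sub_le _ _).trans (add_le_add ?_ ?_)
  · rw [norm_smul, Real.norm_eq_abs, mul_comm 2 r]
    exact mul_le_mul (hR s) ((norm_sub_le _ _).trans (by linarith [hΦ s])) (norm_nonneg _)
      ((abs_nonneg _).trans (hR s))
  · rw [norm_smul, Real.norm_eq_abs]
    exact (mul_le_of_le_one_right (abs_nonneg _) hw).trans
      ((abs_inner_feature_le hΦ s θ).trans hθ)

theorem norm_fst_sub_wStar_sq_le_of_subsingleton (h : IsBoundedModel P μ Φ R r) (hRw : 1 ≤ Rw)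
    (hw₀ : ‖w₀‖ ≤ 1) (hβ : 0 ≤ β) (hβ1 : β ≤ 1) (hG : (1 - β) ^ 2 ≤ G) (x : ℕ → S) (t : ℕ) :
    ‖(𝒵 x t).1 - wStar Φ μ‖ ^ 2 ≤ 4 * G ^ t := by
  induction t with
  | zero =>
    have h1 : ‖w₀ - wStar Φ μ‖ ≤ 2 := (norm_sub_le _ _).trans
      (by linarith [norm_wStar_le h.stationary h.norm_feature_le])
    have h2 : ‖(𝒵 x 0).1 - wStar Φ μ‖ ^ 2 ≤ 2 ^ 2 := pow_le_pow_left₀ (norm_nonneg _) h1 2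
    linarith [pow_zero G]
  | succ t ih =>
    rw [singleChain_fst_succ h.norm_feature_le hβ hβ1 hRw hw₀, norm_add_smul_sub_sub_sq,
      wStar_eq_feature h.stationary (x t), sub_self, inner_zero_right, norm_zero]
    rw [wStar_eq_feature h.stationary (x t)] at ih
    have := mul_le_mul hG ih (sq_nonneg _) ((sq_nonneg _).trans hG)
    rw [pow_succ G]
    linarith

/-- With a single state there is no noise and the error obeys the recursion of mixing time zero. -/
theorem norm_snd_succ_sub_sq_le_of_subsingleton (h : IsBoundedModel P μ Φ R r) (hRw : 1 ≤ Rw)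
    (hϱ : 0 ≤ ϱ) (hw₀ : ‖w₀‖ ≤ 1) (hθ₀ : ‖θ₀‖ ≤ ϱ) (hθstar : ‖θstar‖ ≤ ϱ)
    (hroot : gBar P μ Φ R (wStar Φ μ) θstar = 0) (hlam : 0 < lam) (hα : 0 ≤ α) (hβ : 0 ≤ β)
    (hβ1 : β ≤ 1) (hβα : β ≤ α) (hG : (1 - β) ^ 2 ≤ G) (hG2 : 1 - 2 * β ≤ G) (hG1 : G ≤ 1)
    (x : ℕ → S) (t : ℕ) :
    ‖(𝒵 x (t + 1)).2 - θstar‖ ^ 2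
      ≤ (1 - 2 * α * (eta P μ Φ - lam ^ 2 * (r + 2 * ϱ) / 2)) * ‖(𝒵 x t).2 - θstar‖ ^ 2
        + α * (r + 2 * ϱ) / lam ^ 2 * (4 * G ^ (t + 1) + 6 * α)
        + 4 * α ^ 2 * (r + 3 * ϱ) ^ 2 := by
  have hr := h.bound_nonneg
  have hw := norm_singleChain_fst_le (R := R) (α := α) (ϱ := ϱ) (θ₀ := θ₀) h.norm_feature_le
    hβ hβ1 hRw hw₀ x t
  have hθ := norm_singleChain_snd_le (Φ := Φ) (R := R) (α := α) (β := β) (Rw := Rw) (w₀ := w₀)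
    hϱ hθ₀ x t
  have h0 := norm_singleChain_snd_succ_sub_sq_le (Φ := Φ) (R := R) (α := α) (β := β) (Rw := Rw)
    (w₀ := w₀) (θ₀ := θ₀) hϱ hθstar x t
  have hg := norm_gUpdate_le_of_subsingleton h.norm_feature_le h.abs_reward_le hw hθ
    (x t) (x (t + 1))
  have hg2 := mul_le_mul_of_nonneg_left (pow_le_pow_left₀ (norm_nonneg _) hg 2) (sq_nonneg α)
  rw [gUpdate_eq_gBar h] at h0 hg2
  have hyoung := mul_le_mul_of_nonneg_left
    (inner_gBar_le h hroot hlam hϱ (w := (𝒵 x t).1) hθ) (show 0 ≤ 2 * α by positivity)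
  have hraw := mul_le_mul_of_nonneg_left
    (inner_gBar_le_add_mul h hroot hϱ (w := (𝒵 x t).1) hθ) (show 0 ≤ 2 * α by positivity)
  have hy := norm_fst_sub_wStar_sq_le_of_subsingleton (R := R) (α := α) (ϱ := ϱ) (θ₀ := θ₀)
    h hRw hw₀ hβ hβ1 hG x t
  have he : ‖(𝒵 x t).2 - θstar‖ ≤ 2 * ϱ := (norm_sub_le _ _).trans (by linarith)
  have hy2 : ‖(𝒵 x t).1 - wStar Φ μ‖ ≤ 2 := (norm_sub_le _ _).trans
    (by linarith [norm_wStar_le h.stationary h.norm_feature_le])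
  have hG0 : 0 ≤ G := (sq_nonneg _).trans hG
  have hQ1 : G ^ t ≤ 1 := pow_le_one₀ hG0 hG1
  have hQ0 : 0 ≤ G ^ t := pow_nonneg hG0 t
  rw [pow_succ G]
  set Q := G ^ t
  set y := ‖(𝒵 x t).1 - wStar Φ μ‖
  set e := ‖(𝒵 x t).2 - θstar‖
  set η := eta P μ Φ
  have hQG := mul_le_mul_of_nonneg_left (show 1 - G ≤ 2 * β by linarith) hQ0
  have hk : 0 ≤ α * (r + 2 * ϱ) / lam ^ 2 := by positivity
  have hsplit : 2 * α * ((r + 2 * ϱ) / (2 * lam ^ 2) * y ^ 2)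
      = α * (r + 2 * ϱ) / lam ^ 2 * y ^ 2 := by field_simp
  have hgap : 0 ≤ α ^ 2 * (4 * (r + 3 * ϱ) ^ 2 - (2 * r + ϱ) ^ 2 - 16 * ϱ * (r + 2 * ϱ)) := by
    rw [show 4 * (r + 3 * ϱ) ^ 2 - (2 * r + ϱ) ^ 2 - 16 * ϱ * (r + 2 * ϱ)
      = 4 * r * ϱ + 3 * ϱ ^ 2 by ring]
    positivity
  have hϱr : 0 ≤ α ^ 2 * (16 * ϱ * (r + 2 * ϱ)) := by positivity
  -- Passing from 4G^t to 4G^(t+1) costs up to 8βQ against an allowance of 6α, which suffices when Q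
  -- ≤ 3/4.
  rcases le_total Q (3 / 4) with hQ | hQ
  · have hβQ := mul_le_mul_of_nonneg_right hQ hβ
    have h1 : y ^ 2 ≤ 4 * (Q * G) + 6 * α := by linarith
    have h2 := mul_le_mul_of_nonneg_left h1 hk
    linarith
  -- Otherwise the overrun is at most 2α. If 1/λ² ≤ 8ϱ, the slack `hgap` pays for it. If 1/λ² ≥ 8ϱ,
  -- Young's inequality is skipped: e y ≤ 4ϱ, while the bracket multiplying the forcing is at least
  -- 3, as 4QG ≥ 3(1 − 2β).
  rcases le_total (1 / lam ^ 2) (8 * ϱ) with hl | hl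
  · have hβQ := mul_le_mul_of_nonneg_right hQ1 hβ
    have h1 : y ^ 2 ≤ 4 * (Q * G) + 6 * α + 2 * α := by linarith
    have h2 := mul_le_mul_of_nonneg_left h1 hk
    have h3 := mul_le_mul_of_nonneg_left hl
      (show 0 ≤ α * (r + 2 * ϱ) * (2 * α) by positivity)
    have h4 : α * (r + 2 * ϱ) / lam ^ 2 * (2 * α)
        = α * (r + 2 * ϱ) * (2 * α) * (1 / lam ^ 2) := by ring
    linarith
  · have hQG' := mul_le_mul_of_nonneg_right hQ hG0
    have h1 : 3 ≤ 4 * (Q * G) + 6 * α := by linarith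
    have h2 : e * y ≤ 2 * ϱ * 2 := mul_le_mul he hy2 (norm_nonneg _) (by positivity)
    have h3 := mul_le_mul_of_nonneg_left h2 (show 0 ≤ 2 * α * (r + 2 * ϱ) by positivity)
    have h4 := mul_le_mul_of_nonneg_left h1 hk
    have h5 := mul_le_mul_of_nonneg_left hl (show 0 ≤ α * (r + 2 * ϱ) by positivity)
    have h6 : α * (r + 2 * ϱ) / lam ^ 2 * 3 = 3 * (α * (r + 2 * ϱ) * (1 / lam ^ 2)) := by ring
    have h7 : 0 ≤ α * (r + 2 * ϱ) * (8 * ϱ) := by positivity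
    have h8 : 0 ≤ α * (lam ^ 2 * (r + 2 * ϱ)) * e ^ 2 := by positivity
    linarith

end SingleState

/-! ### Solving the scalar recursion -/

section Recursion

/-- As 1 − κ = 2αζ, the level αC/(2ζ) is the fixed point of x ↦ κx + α²C. The forcing adds one more
ρ^(n+1) per step; the exponent `k + 1` in `hstep` is what gives nρ^n and not nρ^(n−1). -/
theorem le_of_forced_recursion {E : ℕ → ℝ} {α ζ κ G ρ a B C : ℝ} (hα : 0 ≤ α) (hζ : 0 < ζ)
    (hκ : κ = 1 - 2 * α * ζ) (hκ0 : 0 ≤ κ) (hκρ : κ ≤ ρ) (hG0 : 0 ≤ G) (hGρ : G ≤ ρ)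
    (ha : 0 ≤ a) (hC : 0 ≤ C) (h0 : E 0 ≤ B)
    (hstep : ∀ k, E (k + 1) ≤ κ * E k + α * a * (4 * G ^ (k + 1)) + α ^ 2 * C) (n : ℕ) :
    E n ≤ 4 * α * a * n * ρ ^ n + B * κ ^ n + α * C / (2 * ζ) := by
  have hρ0 : 0 ≤ ρ := hG0.trans hGρ
  induction n with
  | zero =>
    have : 0 ≤ α * C / (2 * ζ) := by positivity
    simp only [Nat.cast_zero, pow_zero]
    linarith
  | succ n ih =>
    have h1 := mul_le_mul_of_nonneg_left ih hκ0
    have h2 := mul_le_mul_of_nonneg_left (pow_le_pow_left₀ hG0 hGρ (n + 1))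
      (show 0 ≤ α * a * 4 by positivity)
    have h3 := mul_le_mul_of_nonneg_right hκρ (show 0 ≤ 4 * α * a * n * ρ ^ n by positivity)
    have h4 : κ * (α * C / (2 * ζ)) + α ^ 2 * C = α * C / (2 * ζ) := by
      rw [hκ]
      field_simp
      ring
    have h5 := hstep n
    rw [pow_succ κ]
    rw [pow_succ ρ] at h2 ⊢
    push_cast
    linarith

end Recursion

/-! ### One step of the recursion with the final constants -/

section Step

variable {S : Type*} [Fintype S] [DecidableEq S] {Ω : Type*} [MeasurableSpace Ω]
  {ℙ : Measure Ω} [IsProbabilityMeasure ℙ] {d : ℕ} {Φ : Matrix S (Fin d) ℝ} {R : S → ℝ}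
  {P : Matrix S S ℝ} {μ : S → ℝ} {X : ℕ → Ω → S} {α β Rw ϱ r lam G : ℝ}
  {w₀ θ₀ θstar : EuclideanSpace ℝ (Fin d)}

local notation "𝒵" => singleChain Φ R α β Rw ϱ w₀ θ₀

theorem meanSquare_step (h : IsBoundedModel P μ Φ R r)
    (hX : IsMarkovChain ℙ P X) (hRw : 1 ≤ Rw) (hϱ : 0 ≤ ϱ) (hw₀ : ‖w₀‖ ≤ 1) (hθ₀ : ‖θ₀‖ ≤ ϱ)
    (hθstar : ‖θstar‖ ≤ ϱ) (hroot : gBar P μ Φ R (wStar Φ μ) θstar = 0) (hlam : 0 < lam)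
    (hα : 0 ≤ α) (hα1 : α < 1) (hβ : 0 ≤ β) (hβα : β ≤ α)
    (hG : (1 - β) ^ 2 ≤ G) (hG2 : 1 - 2 * β ≤ G) (hG1 : G ≤ 1) {τ : ℕ}
    (hmix : ∀ s, ∑ s', |(P ^ τ) s s' - μ s'| ≤ min α β) (k : ℕ) :
    ∫ ω, ‖(𝒵 (fun i => X i ω) (k + 1 + τ)).2 - θstar‖ ^ 2 ∂ℙ
      ≤ (1 - 2 * α * (eta P μ Φ - lam ^ 2 * (r + 2 * ϱ) / 2))
          * ∫ ω, ‖(𝒵 (fun i => X i ω) (k + τ)).2 - θstar‖ ^ 2 ∂ℙ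
        + α * (r + 2 * ϱ) / lam ^ 2 * (4 * G ^ (k + 1) + (16 * τ + 6) * α)
        + (88 * τ + 4) * α ^ 2 * (r + 3 * ϱ) ^ 2 := by
  have hr := h.bound_nonneg
  have hβ1 : β ≤ 1 := hβα.trans hα1.le
  have hE : ∀ t, Integrable (fun ω => ‖(𝒵 (fun i => X i ω) t).2 - θstar‖ ^ 2) ℙ := fun t =>
    (dependsUpTo_comp_singleChain t fun _ z => ‖z.2 - θstar‖ ^ 2).integrable hX
  -- At τ = 0 the mixing condition compares point masses with μ within α < 1, which forces a single
  -- state.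
  rcases Nat.eq_zero_or_pos τ with rfl | hτ
  · have : Subsingleton S := subsingleton_of_sum_abs_one_sub_lt h.stationary fun s => by
      have := hmix s
      rw [pow_zero] at this
      exact this.trans_lt ((min_le_left _ _).trans_lt hα1)
    have hint := ((hE k).const_mul
      (1 - 2 * α * (eta P μ Φ - lam ^ 2 * (r + 2 * ϱ) / 2))).add (integrable_const (μ := ℙ)
      (α * (r + 2 * ϱ) / lam ^ 2 * (4 * G ^ (k + 1) + 6 * α) + 4 * α ^ 2 * (r + 3 * ϱ) ^ 2))
    have h1 := integral_mono (hE (k + 1)) hint fun ω => by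
      simpa only [Pi.add_apply, add_assoc] using norm_snd_succ_sub_sq_le_of_subsingleton h hRw hϱ
        hw₀ hθ₀ hθstar hroot hlam hα hβ hβ1 hβα hG hG2 hG1 (fun i => X i ω) k
    rw [integral_add' ((hE k).const_mul _) (integrable_const _), integral_const_mul,
      integral_const, probReal_univ, one_smul] at h1
    simp only [Nat.cast_zero, mul_zero, zero_add, add_zero]
    linarith
  · have h1 := integral_norm_snd_succ_sub_sq_le h hX hRw hϱ hw₀ hθ₀ hθstar hroot hlam hα hβ hβ1
      (k + τ)
    have h2 := integral_norm_fst_sub_sq_le (R := R) (α := α) (ϱ := ϱ) (θ₀ := θ₀) h hX hRw hw₀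
      hβ hβ1 (fun s => (hmix s).trans (min_le_right _ _)) k
    have h3 := integral_tdNoise_le h hX hRw hϱ hw₀ hθ₀ hθstar hα hβ hβ1 hβα hτ
      (fun s => (hmix s).trans (min_le_left _ _)) k
    have hG0 : 0 ≤ G := (sq_nonneg _).trans hG
    have hτ' : (1 : ℝ) ≤ τ := by exact_mod_cast hτ
    -- Since 1 − G ≤ 2β, raising the exponent costs at most 8β; the resulting 4τ + 14 fits under 16τ
    -- + 6 because τ ≥ 1.
    have h4 : 4 * ((1 - β) ^ 2) ^ k + β * (4 * τ + 6)
        ≤ 4 * G ^ (k + 1) + (16 * τ + 6) * α := by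
      have h5 : ((1 - β) ^ 2) ^ k ≤ G ^ k := pow_le_pow_left₀ (sq_nonneg _) hG k
      have h6 : G ^ k ≤ G ^ (k + 1) + 2 * β := by
        rw [pow_succ]
        have := pow_le_one₀ (n := k) hG0 hG1
        nlinarith [pow_nonneg hG0 k]
      have h7 : β * (4 * τ + 14) ≤ α * (16 * τ + 6) :=
        mul_le_mul hβα (by linarith) (by positivity) hα
      linarith
    have h8 := mul_le_mul_of_nonneg_left (h2.trans h4)
      (show 0 ≤ α * (r + 2 * ϱ) / lam ^ 2 by positivity)
    have h9 := mul_le_mul_of_nonneg_left h3 (show 0 ≤ 2 * α by positivity)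
    rw [show k + 1 + τ = k + τ + 1 by ring]
    linarith

end Step

end AvgRewardTD

/-! ### The finite-time bound -/

theorem theorem4 {S A Ω : Type*} [Fintype S] [DecidableEq S] [Fintype A]
    [MeasurableSpace Ω] (ℙ : Measure Ω) [IsProbabilityMeasure ℙ] {d : ℕ}
    (M : AvgRewardTD.FiniteMDP S A) (pol : AvgRewardTD.Policy S A)
    (P : Matrix S S ℝ) (hP : P = M.transMatrix pol)
    (hirr : P.IsIrreducible) (haper : AvgRewardTD.IsAperiodic P)
    (R : S → ℝ) (hR : R = M.rewardVec pol)
    (rmax : ℝ) (hrmax : rmax = M.rMax)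
    (μ : S → ℝ) (hμ : AvgRewardTD.IsStationary P μ)
    (Φ : Matrix S (Fin d) ℝ)
    (hΦnorm : ∀ s, ‖AvgRewardTD.feature Φ s‖ ≤ 1)
    (hΦind : LinearIndependent ℝ Φ.col)
    (X : ℕ → Ω → S) (hX : AvgRewardTD.IsMarkovChain ℙ P X)
    (Rw Rθ : ℝ) (hRw : 1 ≤ Rw) (hRθ : 0 < Rθ)
    (w₀ θ₀ θstar : EuclideanSpace ℝ (Fin d)) (hw₀ : ‖w₀‖ ≤ 1) (hθ₀ : ‖θ₀‖ ≤ Rθ)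
    (hθstar : AvgRewardTD.gBar P μ Φ R (AvgRewardTD.wStar Φ μ) θstar = 0)
    (hθstar_le : ‖θstar‖ ≤ Rθ)
    (α β ρ₀ : ℝ) (hα : 0 < α) (hβ : 0 < β) (hρ₀ : ρ₀ = β / α) (hρ₀_le : ρ₀ ≤ 1)
    (τ : ℕ) (hτ : τ = AvgRewardTD.mixingTime P μ (min α β))
    (η lam ζ : ℝ) (hη : η = AvgRewardTD.eta P μ Φ)
    (hlam : 0 < lam) (hlam_lt : lam ^ 2 < 2 * η / (rmax + 2 * Rθ))
    (hζ : ζ = η - lam ^ 2 * (rmax + 2 * Rθ) / 2) (hα_lt : α < 1 / (2 * ζ))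
    (κ G₁ ρ Gconst : ℝ) (hκ : κ = 1 - 2 * α * ζ)
    (hG₁ : G₁ = Real.exp (-2 * ρ₀ * α)) (hρ : ρ = max κ G₁)
    (hGconst : Gconst = (16 * τ + 6) * (rmax + 2 * Rθ) / lam ^ 2
      + (88 * τ + 4) * (rmax + 3 * Rθ) ^ 2) :
    0 < ζ ∧ κ ∈ Set.Ioo 0 1 ∧ G₁ ∈ Set.Ioo 0 1 ∧ ρ ∈ Set.Ioo 0 1 ∧
    ∀ t : ℕ, τ ≤ t →
      Integrable (fun ω => ‖(AvgRewardTD.singleChain Φ R α β Rw Rθ w₀ θ₀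
        (fun i => X i ω) t).2 - θstar‖ ^ 2) ℙ ∧
      ∫ ω, ‖(AvgRewardTD.singleChain Φ R α β Rw Rθ w₀ θ₀
          (fun i => X i ω) t).2 - θstar‖ ^ 2 ∂ℙ
        ≤ 4 * α * (rmax + 2 * Rθ) * ((t : ℝ) - τ) * ρ ^ (t - τ) / lam ^ 2
          + 4 * Rθ ^ 2 * κ ^ (t - τ)
          + α * Gconst / (2 * ζ) := by
  have hmodel : AvgRewardTD.IsBoundedModel P μ Φ R rmax := by
    subst hP hR hrmax
    exact ⟨M.transMatrix_mem_rowStochastic pol, hμ, hΦnorm, M.abs_rewardVec_le pol,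
      M.rMax_nonneg⟩
  have hr := hmodel.bound_nonneg
  have hk : 0 < rmax + 2 * Rθ := by positivity
  have hζ0 : 0 < ζ := by
    rw [lt_div_iff₀ hk] at hlam_lt
    rw [hζ]
    linarith
  have hζ3 : ζ ≤ 3 := by
    have h1 := AvgRewardTD.eta_le_three (Φ := Φ) hmodel.stochastic hμ hΦnorm
    have h2 : 0 ≤ lam ^ 2 * (rmax + 2 * Rθ) / 2 := by positivity
    rw [hζ, hη]
    linarith
  have hβα : β ≤ α := by rwa [hρ₀, div_le_one hα] at hρ₀_le
  have hGβ : G₁ = Real.exp (-2 * β) := by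
    rw [hG₁, hρ₀, mul_assoc, div_mul_cancel₀ _ hα.ne']
  have hκ0 : 0 < κ := by
    rw [lt_div_iff₀ (by positivity)] at hα_lt
    rw [hκ]
    linarith
  have hκ1 : κ < 1 := by
    have : 0 < 2 * α * ζ := by positivity
    rw [hκ]
    linarith
  have hG0 : 0 < G₁ := hG₁ ▸ Real.exp_pos _
  have hG1 : G₁ < 1 := by
    rw [hGβ, Real.exp_lt_one_iff]
    linarith
  have hκρ : κ ≤ ρ := hρ ▸ le_max_left _ _
  have hGρ : G₁ ≤ ρ := hρ ▸ le_max_right _ _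
  refine ⟨hζ0, ⟨hκ0, hκ1⟩, ⟨hG0, hG1⟩, ⟨hκ0.trans_le hκρ, hρ ▸ max_lt hκ1 hG1⟩,
    fun t ht => ?_⟩
  have hint : ∀ t, Integrable (fun ω => ‖(AvgRewardTD.singleChain Φ R α β Rw Rθ w₀ θ₀
      (fun i => X i ω) t).2 - θstar‖ ^ 2) ℙ := fun t =>
    (AvgRewardTD.dependsUpTo_comp_singleChain t fun _ z => ‖z.2 - θstar‖ ^ 2).integrable hX
  refine ⟨hint t, ?_⟩
  have hbound : ∀ t, ∫ ω, ‖(AvgRewardTD.singleChain Φ R α β Rw Rθ w₀ θ₀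
      (fun i => X i ω) t).2 - θstar‖ ^ 2 ∂ℙ ≤ 4 * Rθ ^ 2 := by
    intro t
    refine (integral_mono (hint t) (integrable_const (4 * Rθ ^ 2)) fun ω => ?_).trans_eq
      (by simp)
    have h0 : ‖(AvgRewardTD.singleChain Φ R α β Rw Rθ w₀ θ₀ (fun i => X i ω) t).2‖ ≤ Rθ :=
      AvgRewardTD.norm_singleChain_snd_le hRθ.le hθ₀ (fun i => X i ω) t
    have h1 : ‖(AvgRewardTD.singleChain Φ R α β Rw Rθ w₀ θ₀ (fun i => X i ω) t).2 - θstar‖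
        ≤ 2 * Rθ := (norm_sub_le _ _).trans (by linarith)
    exact (pow_le_pow_left₀ (norm_nonneg _) h1 2).trans_eq (by ring)
  obtain ⟨n, rfl⟩ := Nat.exists_eq_add_of_le' ht
  rw [Nat.add_sub_cancel, Nat.cast_add, add_sub_cancel_right]
  -- For α ≥ 2/3, ζ ≤ 3 and Gconst ≥ 36R_θ² make the last term at least (2/3) · 36R_θ²/6 = 4R_θ²,
  -- the trivial bound. Below 2/3, β < 1, so 1 − β ≤ exp(−β) may be squared.
  rcases le_or_gt (2 / 3) α with hα_large | hα_small
  · have h1 : 4 * Rθ ^ 2 ≤ α * Gconst / (2 * ζ) := by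
      rw [le_div_iff₀ (by positivity)]
      have h2 : 36 * Rθ ^ 2 ≤ Gconst := by
        have h3 : 0 ≤ (16 * τ + 6) * (rmax + 2 * Rθ) / lam ^ 2
            + (88 * τ * (rmax + 3 * Rθ) ^ 2 + 4 * rmax ^ 2 + 24 * rmax * Rθ) := by positivity
        rw [hGconst]
        linarith
      have h4 := mul_le_mul hα_large h2 (by positivity) hα.le
      have h5 := mul_le_mul_of_nonneg_left hζ3 (sq_nonneg Rθ)
      linarith
    have h2 : 0 ≤ 4 * α * (rmax + 2 * Rθ) * n * ρ ^ n / lam ^ 2 := by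
      have := hκ0.le.trans hκρ
      positivity
    have h3 : 0 ≤ 4 * Rθ ^ 2 * κ ^ n := by positivity
    exact (hbound _).trans (by linarith)
  · have hGsq : (1 - β) ^ 2 ≤ G₁ := by
      rw [hGβ, show -2 * β = -β + -β by ring, Real.exp_add, ← sq]
      exact pow_le_pow_left₀ (by linarith) (by linarith [Real.add_one_le_exp (-β)]) 2
    have hGlin : 1 - 2 * β ≤ G₁ := by
      rw [hGβ]
      linarith [Real.add_one_le_exp (-2 * β)]
    have hstep := AvgRewardTD.meanSquare_step hmodel hX hRw hRθ.le hw₀ hθ₀ hθstar_le hθstar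
      hlam hα.le (hα_small.trans (by norm_num)) hβ.le hβα hGsq hGlin hG1.le (τ := τ)
      fun s => hτ ▸ AvgRewardTD.sum_abs_pow_mixingTime_sub_le hirr haper hmodel.stochastic hμ
        (lt_min hα hβ) s
    rw [← hη, ← hζ, ← hκ] at hstep
    have hfinal := AvgRewardTD.le_of_forced_recursion
      (E := fun k => ∫ ω, ‖(AvgRewardTD.singleChain Φ R α β Rw Rθ w₀ θ₀
        (fun i => X i ω) (k + τ)).2 - θstar‖ ^ 2 ∂ℙ) (a := (rmax + 2 * Rθ) / lam ^ 2)
      (C := Gconst) hα.le hζ0 hκ hκ0.le hκρ hG0.le hGρ (by positivity)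
      (by rw [hGconst]; positivity) (hbound _)
      (fun k => (hstep k).trans_eq (by rw [hGconst]; ring)) n
    refine hfinal.trans_eq ?_
    ring
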